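/- Let $d\in\{2,3\}$, let $\nu,\lambda,\Gamma,L,c>0$ and $a,b,\xi\in\mathbb R$ be constants, and let $\mathbb T^d=\mathbb R^d/\mathbb Z^d$. Repeated indices are summed from $1$ to $d$; $(\nabla u)_{ij}=\nabla_j u_i$, $(\nabla\cdot\sigma)_i=\nabla_j\sigma_{ij}$, $A:B=A_{ij}B_{ij}$, $\mathbb I$ is the identity matrix, and $$D=\tfrac12(\nabla u+\nabla^T u),\qquad \Omega=\tfrac12(\nabla u-\nabla^T u),$$ $$F(Q)=-aQ+b\big(Q^2-\tfrac1d\mathrm{tr}(Q^2)\mathbb I\big)-c\,\mathrm{tr}(Q^2)\,Q,\qquad H=H(Q)=L\Delta Q+F(Q),$$ $$S(\nabla u,Q)=(\xi D+\Omega)\big(Q+\tfrac1d\mathbb I\big)+\big(Q+\tfrac1d\mathbb I\big)(\xi D-\Omega)-2\xi\big(Q+\tfrac1d\mathbb I\big)\mathrm{tr}(Q\nabla u),$$ $$\tau=-\xi\big(Q+\tfrac1d\mathbb I\big)H-\xi H\big(Q+\tfrac1d\mathbb I\big)+2\xi\big(Q+\tfrac1d\mathbb I\big)\mathrm{tr}(QH)-L\,\nabla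 Q\odot\nabla Q,\qquad \sigma=QH-HQ,$$ where $(\nabla Q\odot\nabla Q)_{ij}=\nabla_iQ_{kl}\nabla_jQ_{kl}$. For a matrix $B$, $\frac{\partial F(Q)}{\partial Q}B$ denotes the derivative of $F$ at $Q$ in the direction $B$. Let $(u,Q)$, with $u:\mathbb T^d\times(0,\infty)\to\mathbb R^d$ and $Q:\mathbb T^d\times(0,\infty)\to\{\text{symmetric traceless } d\times d \text{ matrices}\}$, be a smooth solution, with pressure $P$, of $$u_t+u\cdot\nabla u-\nu\Delta u+\nabla P=\lambda\nabla\cdot(\tau+\sigma),\qquad \nabla\cdot u=0,\qquad Q_t+u\cdot\nabla Q-S(\nabla u,Q)=\Gamma H(Q),$$ and put $$\mathcal A(t)=\|\nabla u(t)\|_{L^2}^2+\frac{\lambda}{L}\|H(Q(t))\|_{L^2}^2 .$$ Then $\mathcal A$ is differentiable at every $t>0$ and $$\frac12\frac{d}{dt}\mathcal A(t)+\nu\|\Delta u\|_{L^2}^2+\lambda\Gamma\|\nabla H\|_{L^2}^2=\sum_{i=1}^{12}J_i,$$ where, all integrals being over $\mathbb T^d$ at time $t$, $$J_1=\int (u\cdot\nabla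 u)\cdot\Delta u,\qquad J_2=-2\lambda\int\nabla_lu_k\,\nabla_l\nabla_kQ_{ij}\,H_{ij},\qquad J_3=\frac\lambda L\int u_k\nabla_kF_{ij}\,H_{ij},$$ $$J_4=-2\lambda\int\nabla_ju_i\big(\nabla_lQ_{kj}\nabla_lH_{ik}-\nabla_lQ_{ik}\nabla_lH_{kj}\big),\qquad J_5=-\lambda\int\nabla_ju_i\big(\Delta Q_{kj}H_{ik}-\Delta Q_{ik}H_{kj}\big),$$ $$J_6=\lambda\xi\int(D\Delta Q+\Delta Q\,D):H,\qquad J_7=4\lambda\xi\int\nabla_lD_{ik}\nabla_lQ_{kj}H_{ij},$$ $$J_8=-2\lambda\xi\int\Delta(Q_{kl}Q_{ji})\nabla_ju_i\,H_{kl},\qquad J_9=-4\lambda\xi\int\nabla_m(Q_{kl}Q_{ji})\nabla_m\nabla_ju_i\,H_{kl},$$ $$J_{10}=-\frac\lambda L\int\frac{\partial F(Q)}{\partial Q}(u\cdot\nabla Q):H,\qquad J_{11}=\frac\lambda L\int\frac{\partial F(Q)}{\partial Q}S(\nabla u,Q):H,\qquad J_{12}=\frac{\lambda\Gamma}L\int\frac{\partial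 F(Q)}{\partial Q}H:H .$$ Moreover, the two parts of $\mathcal A$ are differentiable and satisfy $$\frac12\frac{d}{dt}\|\nabla u\|_{L^2}^2+\nu\|\Delta u\|_{L^2}^2=J_1+X_a+X_b+X_c+X_d,$$ $$\frac{\lambda}{2L}\frac{d}{dt}\|H\|_{L^2}^2+\lambda\Gamma\|\nabla H\|_{L^2}^2=Y_a+Y_b+Y_c+Y_d+\sum_{i=2}^{12}J_i,$$ with $$X_a=-\lambda\int(\nabla\cdot\sigma)\cdot\Delta u,\qquad Y_a=\lambda\int\nabla_j\big(Q_{ik}H_{kj}-Q_{kj}H_{ik}\big)\Delta u_i,$$ $$X_b=\lambda L\int\nabla_j\big(\nabla_iQ_{kl}\nabla_jQ_{kl}\big)\Delta u_i,\qquad Y_b=-\lambda\int\Delta u_k\nabla_kQ_{ij}H_{ij},$$ $$X_c=\lambda\xi\int\nabla_j\big(Q_{ik}H_{kj}+H_{ik}Q_{kj}+\tfrac2dH_{ij}\big)\Delta u_i,\qquad Y_c=\lambda\xi\int\big(\Delta D\,Q+Q\,\Delta D+\tfrac2d\Delta D\big):H,$$ $$X_d=-2\lambda\xi\int\nabla_j\big(Q_{kl}H_{kl}(Q_{ij}+\tfrac1d\delta_{ij})\big)\Delta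 u_i,\qquad Y_d=2\lambda\xi\int\nabla_j\big(Q_{kl}H_{kl}Q_{ji}\big)\Delta u_i,$$ and these highly nonlinear terms cancel in pairs: $X_a+Y_a=X_b+Y_b=X_c+Y_c=X_d+Y_d=0$. When $\xi=0$, the terms $X_c,Y_c,X_d,Y_d$ are all zero. -/

import Mathlib

open scoped ContDiff

noncomputable section

namespace BerisEdwards

variable {d : ℕ}

/-! ### Calculus for functions on the unit periodic box, seen as `1`-periodic functions on `ℝ ^ d` -/

/-- The `k`-th partial derivative of a scalar function. -/
def pd (k : Fin d) (f : (Fin d → ℝ) → ℝ) : (Fin d → ℝ) → ℝ :=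
  fun x => fderiv ℝ f x (Pi.single k 1)

/-- The Laplacian of a scalar function. -/
def lap (f : (Fin d → ℝ) → ℝ) : (Fin d → ℝ) → ℝ :=
  fun x => ∑ k, pd k (pd k f) x

/-- `f` has period `1` in every coordinate direction. -/
def IsPeriodic {α : Type*} (f : (Fin d → ℝ) → α) : Prop :=
  ∀ (x : Fin d → ℝ) (k : Fin d), f (x + Pi.single k 1) = f x

/-- The integral over the periodic cell `[0, 1] ^ d`. -/
def cellInt (f : (Fin d → ℝ) → ℝ) : ℝ :=
  ∫ x in Set.Icc (0 : Fin d → ℝ) 1, f x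

/-- Componentwise Laplacian of a vector field. -/
def lapVec (v : (Fin d → ℝ) → Fin d → ℝ) : (Fin d → ℝ) → Fin d → ℝ :=
  fun x i => lap (fun y => v y i) x

/-- Componentwise Laplacian of a matrix field. -/
def lapMat (A : (Fin d → ℝ) → Matrix (Fin d) (Fin d) ℝ) :
    (Fin d → ℝ) → Matrix (Fin d) (Fin d) ℝ :=
  fun x => Matrix.of fun i j => lap (fun y => A y i j) x

/-- Componentwise partial derivative of a matrix field. -/
def pdMat (k : Fin d) (A : (Fin d → ℝ) → Matrix (Fin d) (Fin d) ℝ) :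
    (Fin d → ℝ) → Matrix (Fin d) (Fin d) ℝ :=
  fun x => Matrix.of fun i j => pd k (fun y => A y i j) x

/-- Divergence of a vector field. -/
def divVec (v : (Fin d → ℝ) → Fin d → ℝ) : (Fin d → ℝ) → ℝ :=
  fun x => ∑ i, pd i (fun y => v y i) x

/-- Divergence of a matrix field: `(∇ · A)_i = ∇_j A_ij`. -/
def divMat (A : (Fin d → ℝ) → Matrix (Fin d) (Fin d) ℝ) : (Fin d → ℝ) → Fin d → ℝ :=
  fun x i => ∑ j, pd j (fun y => A y i j) x

/-- The convective derivative `v · ∇ w` of a vector field. -/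
def advVec (v w : (Fin d → ℝ) → Fin d → ℝ) : (Fin d → ℝ) → Fin d → ℝ :=
  fun x i => ∑ k, v x k * pd k (fun y => w y i) x

/-- The convective derivative `v · ∇ A` of a matrix field. -/
def advMat (v : (Fin d → ℝ) → Fin d → ℝ) (A : (Fin d → ℝ) → Matrix (Fin d) (Fin d) ℝ) :
    (Fin d → ℝ) → Matrix (Fin d) (Fin d) ℝ :=
  fun x => ∑ k, v x k • pdMat k A x

/-- The contraction `A : B = A_ij B_ij` (equal to `tr (A B)` when `A` or `B` is symmetric). -/
def frob (A B : Matrix (Fin d) (Fin d) ℝ) : ℝ :=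
  ∑ i, ∑ j, A i j * B i j

/-- The velocity gradient, `(∇ v)_ij = ∇_j v_i`. -/
def gradVel (v : (Fin d → ℝ) → Fin d → ℝ) : (Fin d → ℝ) → Matrix (Fin d) (Fin d) ℝ :=
  fun x => Matrix.of fun i j => pd j (fun y => v y i) x

/-- `D = (∇ v + ∇ᵀ v) / 2`. -/
def strain (v : (Fin d → ℝ) → Fin d → ℝ) : (Fin d → ℝ) → Matrix (Fin d) (Fin d) ℝ :=
  fun x => (1 / 2 : ℝ) • (gradVel v x + (gradVel v x).transpose)

/-- `Ω = (∇ v - ∇ᵀ v) / 2`. -/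
def vorticity (v : (Fin d → ℝ) → Fin d → ℝ) : (Fin d → ℝ) → Matrix (Fin d) (Fin d) ℝ :=
  fun x => (1 / 2 : ℝ) • (gradVel v x - (gradVel v x).transpose)

/-! ### The Navier–Stokes and Q-tensor system -/

/-- The constants of the system: viscosity `ν`, energy ratio `lam` (usually written with the
letter lambda), relaxation constant `Γ`, elastic constant `L`, bulk constants `a`, `b`, `c`,
and the tumbling/aligning ratio `ξ`. -/
structure Params where
  ν : ℝ
  lam : ℝ
  Γ : ℝ
  L : ℝ
  a : ℝ
  b : ℝ
  c : ℝ
  ξ : ℝ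

/-- The sign requirements on the constants (`a`, `b`, `ξ` are arbitrary). -/
structure Params.Admissible (p : Params) : Prop where
  ν_pos : 0 < p.ν
  lam_pos : 0 < p.lam
  Γ_pos : 0 < p.Γ
  L_pos : 0 < p.L
  c_pos : 0 < p.c

/-- `F(M) = - a M + b (M² - (1/d) tr(M²) I) - c tr(M²) M`. -/
def bulkF (p : Params) (M : Matrix (Fin d) (Fin d) ℝ) : Matrix (Fin d) (Fin d) ℝ :=
  -(p.a • M) + p.b • (M * M - ((1 / (d : ℝ)) * (M * M).trace) • (1 : Matrix (Fin d) (Fin d) ℝ))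
    - (p.c * (M * M).trace) • M

/-- `(∂F(M)/∂Q) B`: the derivative of `F` at `M` in the direction `B`. -/
def bulkFDeriv (p : Params) (M B : Matrix (Fin d) (Fin d) ℝ) : Matrix (Fin d) (Fin d) ℝ :=
  Matrix.of fun i j => lineDeriv ℝ (fun N : Matrix (Fin d) (Fin d) ℝ => bulkF p N i j) M B

/-- The molecular field `H(Q) = L Δ Q + F(Q)`. -/
def molField (p : Params) (Q : (Fin d → ℝ) → Matrix (Fin d) (Fin d) ℝ) :
    (Fin d → ℝ) → Matrix (Fin d) (Fin d) ℝ :=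
  fun x => p.L • lapMat Q x + bulkF p (Q x)

/-- `Q + I / d`. -/
def shifted (M : Matrix (Fin d) (Fin d) ℝ) : Matrix (Fin d) (Fin d) ℝ :=
  M + (1 / (d : ℝ)) • (1 : Matrix (Fin d) (Fin d) ℝ)

/-- `S(∇v, Q)`. -/
def tumbling (p : Params) (v : (Fin d → ℝ) → Fin d → ℝ)
    (Q : (Fin d → ℝ) → Matrix (Fin d) (Fin d) ℝ) :
    (Fin d → ℝ) → Matrix (Fin d) (Fin d) ℝ :=
  fun x => (p.ξ • strain v x + vorticity v x) * shifted (Q x)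
    + shifted (Q x) * (p.ξ • strain v x - vorticity v x)
    - (2 * p.ξ * (Q x * gradVel v x).trace) • shifted (Q x)

/-- `(∇Q ⊙ ∇Q)_ij = ∇_i Q_kl ∇_j Q_kl`. -/
def gradOdot (Q : (Fin d → ℝ) → Matrix (Fin d) (Fin d) ℝ) :
    (Fin d → ℝ) → Matrix (Fin d) (Fin d) ℝ :=
  fun x => Matrix.of fun i j => frob (pdMat i Q x) (pdMat j Q x)

/-- The symmetric stress `τ`. -/
def symStress (p : Params) (Q : (Fin d → ℝ) → Matrix (Fin d) (Fin d) ℝ) :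
    (Fin d → ℝ) → Matrix (Fin d) (Fin d) ℝ :=
  fun x => -(p.ξ • (shifted (Q x) * molField p Q x)) - p.ξ • (molField p Q x * shifted (Q x))
    + (2 * p.ξ * (Q x * molField p Q x).trace) • shifted (Q x) - p.L • gradOdot Q x

/-- The skew-symmetric stress `σ = Q H - H Q`. -/
def skewStress (p : Params) (Q : (Fin d → ℝ) → Matrix (Fin d) (Fin d) ℝ) :
    (Fin d → ℝ) → Matrix (Fin d) (Fin d) ℝ :=
  fun x => Q x * molField p Q x - molField p Q x * Q x

/-- `(u, Q)` with the pressure `P` is a smooth spatially periodic solution for positive times.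
The first argument of `u`, `P`, `Q` is time. -/
structure IsSmoothSolution (p : Params) (u : ℝ → (Fin d → ℝ) → Fin d → ℝ)
    (P : ℝ → (Fin d → ℝ) → ℝ) (Q : ℝ → (Fin d → ℝ) → Matrix (Fin d) (Fin d) ℝ) : Prop where
  smooth_u : ∀ i, ContDiffOn ℝ ∞ (fun z : ℝ × (Fin d → ℝ) => u z.1 z.2 i)
    (Set.Ioi 0 ×ˢ Set.univ)
  smooth_Q : ∀ i j, ContDiffOn ℝ ∞ (fun z : ℝ × (Fin d → ℝ) => Q z.1 z.2 i j)
    (Set.Ioi 0 ×ˢ Set.univ)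
  smooth_P : ∀ t, 0 < t → ContDiff ℝ ∞ (P t)
  periodic_u : ∀ t, 0 < t → IsPeriodic (u t)
  periodic_Q : ∀ t, 0 < t → IsPeriodic (Q t)
  periodic_P : ∀ t, 0 < t → IsPeriodic (P t)
  symm_Q : ∀ t, 0 < t → ∀ x, (Q t x).IsSymm
  trace_Q : ∀ t, 0 < t → ∀ x, (Q t x).trace = 0
  momentum : ∀ t, 0 < t → ∀ x i,
    deriv (fun s => u s x i) t + advVec (u t) (u t) x i - p.ν * lapVec (u t) x i + pd i (P t) x
      = p.lam * divMat (fun y => symStress p (Q t) y + skewStress p (Q t) y) x i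
  incompressible : ∀ t, 0 < t → ∀ x, divVec (u t) x = 0
  order : ∀ t, 0 < t → ∀ x i j,
    deriv (fun s => Q s x i j) t + advMat (u t) (Q t) x i j - tumbling p (u t) (Q t) x i j
      = p.Γ * molField p (Q t) x i j

/-! ### Norms and the quantity `A` -/

/-- `‖∇v‖²`. -/
def gradVelSq (v : (Fin d → ℝ) → Fin d → ℝ) : ℝ :=
  cellInt fun x => frob (gradVel v x) (gradVel v x)

/-- `‖Δv‖²`. -/
def lapVelSq (v : (Fin d → ℝ) → Fin d → ℝ) : ℝ :=
  cellInt fun x => ∑ i, lapVec v x i ^ 2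

/-- `‖H(Q)‖²`. -/
def molSq (p : Params) (Q : (Fin d → ℝ) → Matrix (Fin d) (Fin d) ℝ) : ℝ :=
  cellInt fun x => frob (molField p Q x) (molField p Q x)

/-- `‖∇H(Q)‖²`. -/
def gradMolSq (p : Params) (Q : (Fin d → ℝ) → Matrix (Fin d) (Fin d) ℝ) : ℝ :=
  cellInt fun x => ∑ k, frob (pdMat k (molField p Q) x) (pdMat k (molField p Q) x)

/-- `A = ‖∇v‖² + (lam / L) ‖H(Q)‖²`. -/
def energyA (p : Params) (v : (Fin d → ℝ) → Fin d → ℝ)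
    (Q : (Fin d → ℝ) → Matrix (Fin d) (Fin d) ℝ) : ℝ :=
  gradVelSq v + p.lam / p.L * molSq p Q

/-! ### The twelve integrals -/

section Integrals

variable (p : Params) (v : (Fin d → ℝ) → Fin d → ℝ)
  (Q : (Fin d → ℝ) → Matrix (Fin d) (Fin d) ℝ)

def J1 : ℝ := cellInt fun x => ∑ i, advVec v v x i * lapVec v x i

def J2 : ℝ := -2 * p.lam * cellInt fun x => ∑ i, ∑ j, ∑ k, ∑ l,
  pd l (fun y => v y k) x * pd l (pd k fun y => Q y i j) x * molField p Q x i j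

def J3 : ℝ := p.lam / p.L * cellInt fun x => ∑ i, ∑ j, ∑ k,
  v x k * pd k (fun y => bulkF p (Q y) i j) x * molField p Q x i j

def J4 : ℝ := -2 * p.lam * cellInt fun x => ∑ i, ∑ j, ∑ k, ∑ l,
  pd j (fun y => v y i) x *
    (pd l (fun y => Q y k j) x * pd l (fun y => molField p Q y i k) x
      - pd l (fun y => Q y i k) x * pd l (fun y => molField p Q y k j) x)

def J5 : ℝ := -p.lam * cellInt fun x => ∑ i, ∑ j, ∑ k,
  pd j (fun y => v y i) x *
    (lapMat Q x k j * molField p Q x i k - lapMat Q x i k * molField p Q x k j)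

def J6 : ℝ := p.lam * p.ξ * cellInt fun x =>
  frob (strain v x * lapMat Q x + lapMat Q x * strain v x) (molField p Q x)

def J7 : ℝ := 4 * p.lam * p.ξ * cellInt fun x => ∑ i, ∑ j, ∑ k, ∑ l,
  pd l (fun y => strain v y i k) x * pd l (fun y => Q y k j) x * molField p Q x i j

def J8 : ℝ := -2 * p.lam * p.ξ * cellInt fun x => ∑ i, ∑ j, ∑ k, ∑ l,
  lap (fun y => Q y k l * Q y j i) x * pd j (fun y => v y i) x * molField p Q x k l

def J9 : ℝ := -4 * p.lam * p.ξ * cellInt fun x => ∑ i, ∑ j, ∑ k, ∑ l, ∑ m,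
  pd m (fun y => Q y k l * Q y j i) x * pd m (pd j fun y => v y i) x * molField p Q x k l

def J10 : ℝ := -(p.lam / p.L) * cellInt fun x =>
  frob (bulkFDeriv p (Q x) (advMat v Q x)) (molField p Q x)

def J11 : ℝ := p.lam / p.L * cellInt fun x =>
  frob (bulkFDeriv p (Q x) (tumbling p v Q x)) (molField p Q x)

def J12 : ℝ := p.lam / p.L * p.Γ * cellInt fun x =>
  frob (bulkFDeriv p (Q x) (molField p Q x)) (molField p Q x)

/-! ### The pairs of terms that cancel

`velTerm…` are the contributions to the balance of `‖∇v‖²`, `molTerm…` those to the balance of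
`(lam / L) ‖H‖²`. -/

def velTermA : ℝ := -p.lam * cellInt fun x => ∑ i, divMat (skewStress p Q) x i * lapVec v x i

def molTermA : ℝ := p.lam * cellInt fun x => ∑ i, ∑ j, ∑ k,
  pd j (fun y => Q y i k * molField p Q y k j - Q y k j * molField p Q y i k) x * lapVec v x i

def velTermB : ℝ := p.lam * p.L * cellInt fun x => ∑ i, divMat (gradOdot Q) x i * lapVec v x i

def molTermB : ℝ := -p.lam * cellInt fun x => ∑ i, ∑ j, ∑ k,
  lapVec v x k * pd k (fun y => Q y i j) x * molField p Q x i j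

def velTermC : ℝ := p.lam * p.ξ * cellInt fun x => ∑ i,
  divMat (fun y => Q y * molField p Q y + molField p Q y * Q y
    + (2 / (d : ℝ)) • molField p Q y) x i * lapVec v x i

def molTermC : ℝ := p.lam * p.ξ * cellInt fun x =>
  frob (lapMat (strain v) x * Q x + Q x * lapMat (strain v) x
    + (2 / (d : ℝ)) • lapMat (strain v) x) (molField p Q x)

def velTermD : ℝ := -2 * p.lam * p.ξ * cellInt fun x => ∑ i,
  divMat (fun y => frob (Q y) (molField p Q y) • shifted (Q y)) x i * lapVec v x i

def molTermD : ℝ := 2 * p.lam * p.ξ * cellInt fun x => ∑ i,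
  divMat (fun y => frob (Q y) (molField p Q y) • Q y) x i * lapVec v x i

end Integrals

end BerisEdwards

end

/-! The identity is two energy computations added together, followed by cancellations. Testing the
momentum equation with `-Δu` gives the balance of `‖∇u‖²`. The pressure disappears because `Δu` is
divergence free, convection gives `J1`, and the stress splits into four pieces that give `X_a`, …,
`X_d`.

For `‖H‖²`, differentiate `H = LΔQ + F(Q)` in time and insert the equation for `Q_t`. The part
`F'(Q)Q_t` gives `J10`, `J11`, `J12`. In `Δ(Q_t) : H` the relaxation term gives the dissipation
`-‖∇H‖²`, and the rest is expanded by the Leibniz rule for `Δ`. The products carrying the third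
derivatives of `u` give `Y_a`, `Y_c`, `Y_d`, and the product `Δu · ∇Q` gives `Y_b`. The remaining
products are `J2`–`J9` (`intTr_laplaceM_tumble`, `intTr_laplaceM_adv`). The third derivatives of `Q`
from transport are removed because `u · ∇H : H` integrates to zero.

Each pair `X + Y` vanishes for its own reason: `a` because both integrands are `(∇·σ) · Δu`; `b`
because the elastic stress and the bulk force are of gradient type up to `∇Q : H`; `c` because a
symmetric stress sees only the symmetric part of `∇Δu`; `d` because an isotropic stress is a
pressure.

The space computations use only commuting derivations on a commutative algebra and a functional
vanishing on derivatives. They are therefore carried out in an abstract `PeriodicCalculus`, then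
applied to smooth periodic functions (`boxCalculus`), where the divergence theorem on the cell
supplies the functional. Time enters only through differentiation under the integral and the
commutation of `∂_t` with `∂_k`, after which `u_t` and `Q_t` are replaced by the elements that the
equations prescribe. -/

noncomputable section

namespace BerisEdwards

variable {d : ℕ}

/-! ### Algebraic calculus on a periodic box

A commutative real algebra with commuting derivations and a linear functional that vanishes on
derivatives: all integrations by parts take place in this setting. -/

/-- Commuting derivations together with a functional that kills every derivative. -/
structure PeriodicCalculus (d : ℕ) (R : Type*) [CommRing R] [Algebra ℝ R] where
  der : Fin d → Derivation ℝ R R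
  der_comm : ∀ k l f, der k (der l f) = der l (der k f)
  int : R →ₗ[ℝ] ℝ
  int_der : ∀ k f, int (der k f) = 0

namespace PeriodicCalculus

variable {R : Type*} [CommRing R] [Algebra ℝ R] (C : PeriodicCalculus d R)

/-- The Laplacian. -/
def laplace : R →ₗ[ℝ] R := ∑ k, (C.der k : R →ₗ[ℝ] R) ∘ₗ (C.der k : R →ₗ[ℝ] R)

/-- Entrywise derivation of a matrix. -/
def derM (k : Fin d) : Matrix (Fin d) (Fin d) R →ₗ[ℝ] Matrix (Fin d) (Fin d) R :=
  (C.der k : R →ₗ[ℝ] R).mapMatrix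

/-- Entrywise Laplacian of a matrix. -/
def laplaceM : Matrix (Fin d) (Fin d) R →ₗ[ℝ] Matrix (Fin d) (Fin d) R :=
  C.laplace.mapMatrix

/-- The integral of the trace. -/
def intTr : Matrix (Fin d) (Fin d) R →ₗ[ℝ] ℝ :=
  C.int ∘ₗ Matrix.traceLinearMap (Fin d) ℝ R

/-- The gradient `(∇ v)_ij = ∇_j v_i`. -/
def grad (v : Fin d → R) : Matrix (Fin d) (Fin d) R := Matrix.of fun i j => C.der j (v i)

/-- The divergence of a vector. -/
def div (v : Fin d → R) : R := ∑ i, C.der i (v i)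

/-- The divergence of a matrix. -/
def divM (A : Matrix (Fin d) (Fin d) R) : Fin d → R := fun i => ∑ j, C.der j (A i j)

/-- The convective derivative of a matrix. -/
def advM (v : Fin d → R) (A : Matrix (Fin d) (Fin d) R) : Matrix (Fin d) (Fin d) R :=
  ∑ k, v k • C.derM k A

lemma laplace_apply (f : R) : C.laplace f = ∑ k, C.der k (C.der k f) := by
  simp [laplace, LinearMap.sum_apply]

@[simp] lemma derM_apply (k : Fin d) (A : Matrix (Fin d) (Fin d) R) (i j : Fin d) :
    C.derM k A i j = C.der k (A i j) := rfl

@[simp] lemma laplaceM_apply (A : Matrix (Fin d) (Fin d) R) (i j : Fin d) :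
    C.laplaceM A i j = C.laplace (A i j) := rfl

@[simp] lemma grad_apply (v : Fin d → R) (i j : Fin d) : C.grad v i j = C.der j (v i) := rfl

lemma intTr_apply (A : Matrix (Fin d) (Fin d) R) : C.intTr A = C.int A.trace := rfl

lemma laplaceM_eq (A : Matrix (Fin d) (Fin d) R) :
    C.laplaceM A = ∑ k, C.derM k (C.derM k A) := by
  ext i j
  simp [Matrix.sum_apply, laplace_apply]

lemma der_mul (k : Fin d) (f g : R) : C.der k (f * g) = C.der k f * g + f * C.der k g := by
  rw [Derivation.leibniz, smul_eq_mul, smul_eq_mul]; ring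

lemma der_laplace (k : Fin d) (f : R) : C.der k (C.laplace f) = C.laplace (C.der k f) := by
  simp only [laplace_apply, map_sum]
  refine Finset.sum_congr rfl fun l _ => ?_
  rw [C.der_comm k l, C.der_comm k l f]

lemma laplace_mul (f g : R) : C.laplace (f * g)
    = C.laplace f * g + (2 : ℝ) • ∑ k, C.der k f * C.der k g + f * C.laplace g := by
  simp only [laplace_apply, Finset.sum_mul, Finset.mul_sum, Finset.smul_sum,
    ← Finset.sum_add_distrib]
  refine Finset.sum_congr rfl fun l _ => ?_
  simp only [C.der_mul, map_add, two_smul]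
  ring

lemma derM_comm (k l : Fin d) (A : Matrix (Fin d) (Fin d) R) :
    C.derM k (C.derM l A) = C.derM l (C.derM k A) := by
  ext i j; simp [C.der_comm k l]

lemma derM_laplaceM (k : Fin d) (A : Matrix (Fin d) (Fin d) R) :
    C.derM k (C.laplaceM A) = C.laplaceM (C.derM k A) := by
  ext i j; simp [C.der_laplace]

lemma derM_mul (k : Fin d) (A B : Matrix (Fin d) (Fin d) R) :
    C.derM k (A * B) = C.derM k A * B + A * C.derM k B := by
  ext i j
  simp [Matrix.mul_apply, C.der_mul, Finset.sum_add_distrib]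

lemma laplaceM_smul (f : R) (A : Matrix (Fin d) (Fin d) R) : C.laplaceM (f • A)
    = C.laplace f • A + (2 : ℝ) • ∑ k, C.der k f • C.derM k A + f • C.laplaceM A := by
  ext i j
  simp [C.laplace_mul, Matrix.sum_apply]

lemma laplaceM_mul (A B : Matrix (Fin d) (Fin d) R) : C.laplaceM (A * B)
    = C.laplaceM A * B + (2 : ℝ) • ∑ k, C.derM k A * C.derM k B + A * C.laplaceM B := by
  simp only [laplaceM_eq, Finset.sum_mul, Finset.mul_sum, Finset.smul_sum,
    ← Finset.sum_add_distrib]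
  refine Finset.sum_congr rfl fun l _ => ?_
  simp only [C.derM_mul, map_add, two_smul]
  abel

lemma derM_transpose (k : Fin d) (A : Matrix (Fin d) (Fin d) R) :
    C.derM k A.transpose = (C.derM k A).transpose := rfl

lemma laplaceM_transpose (A : Matrix (Fin d) (Fin d) R) :
    C.laplaceM A.transpose = (C.laplaceM A).transpose := rfl

lemma derM_one (k : Fin d) : C.derM k (1 : Matrix (Fin d) (Fin d) R) = 0 := by
  ext i j
  by_cases h : i = j <;> simp [h]

lemma der_trace (k : Fin d) (A : Matrix (Fin d) (Fin d) R) :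
    C.der k A.trace = (C.derM k A).trace := by
  simp [Matrix.trace]

lemma laplace_trace (A : Matrix (Fin d) (Fin d) R) :
    C.laplace A.trace = (C.laplaceM A).trace := by
  simp [Matrix.trace]

lemma intTr_mul_comm (A B : Matrix (Fin d) (Fin d) R) : C.intTr (A * B) = C.intTr (B * A) := by
  rw [intTr_apply, intTr_apply, Matrix.trace_mul_comm]

lemma int_der_mul (k : Fin d) (f g : R) :
    C.int (C.der k f * g) = -C.int (f * C.der k g) := by
  have h := C.int_der k (f * g)
  rw [C.der_mul, map_add] at h
  linarith

lemma intTr_derM_mul (k : Fin d) (A B : Matrix (Fin d) (Fin d) R) :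
    C.intTr (C.derM k A * B) = -C.intTr (A * C.derM k B) := by
  have h := C.int_der k (A * B).trace
  rw [C.der_trace, C.derM_mul, ← intTr_apply, map_add] at h
  linarith

lemma intTr_laplaceM_mul (A B : Matrix (Fin d) (Fin d) R) :
    C.intTr (C.laplaceM A * B) = -∑ k, C.intTr (C.derM k A * C.derM k B) := by
  rw [laplaceM_eq, Finset.sum_mul, map_sum, ← Finset.sum_neg_distrib]
  exact Finset.sum_congr rfl fun k _ => C.intTr_derM_mul k _ _

/-- Integration by parts for the divergence of a matrix tested against a vector. -/
lemma int_divM_mul (A : Matrix (Fin d) (Fin d) R) (w : Fin d → R) :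
    C.int (∑ i, C.divM A i * w i) = -C.intTr (A * (C.grad w).transpose) := by
  simp only [intTr_apply, divM, Finset.sum_mul, map_sum, Matrix.trace, Matrix.diag,
    Matrix.mul_apply, Matrix.transpose_apply, grad_apply, C.int_der_mul,
    ← Finset.sum_neg_distrib]

/-- A gradient is orthogonal to a divergence-free vector. -/
lemma int_der_mul_eq_zero (f : R) {w : Fin d → R} (hw : C.div w = 0) :
    C.int (∑ i, C.der i f * w i) = 0 := by
  have : C.int (∑ i, C.der i f * w i) = -C.int (f * C.div w) := by
    simp only [div, Finset.mul_sum, map_sum, C.int_der_mul, ← Finset.sum_neg_distrib]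
  rw [this, hw, mul_zero, map_zero, neg_zero]

lemma grad_laplace (v : Fin d → R) :
    C.grad (fun i => C.laplace (v i)) = C.laplaceM (C.grad v) := by
  ext i j; simp [C.der_laplace]

lemma div_laplace {v : Fin d → R} (hv : C.div v = 0) :
    C.div (fun i => C.laplace (v i)) = 0 := by
  simp only [div, C.der_laplace, ← map_sum] at hv ⊢
  rw [hv, map_zero]

/-- Half the derivative of the squared gradient, after an integration by parts. -/
lemma int_grad_mul_grad (v w : Fin d → R) :
    C.int (∑ i, ∑ j, C.der j (v i) * C.der j (w i)) = -C.int (∑ i, C.laplace (v i) * w i) := by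
  simp only [laplace_apply, Finset.sum_mul, map_sum, C.int_der_mul, Finset.sum_neg_distrib, neg_neg]

variable (p : Params)

/-! ### The system over an algebra with derivations -/

/-- `A : B`. -/
def contract (A B : Matrix (Fin d) (Fin d) R) : R := ∑ i, ∑ j, A i j * B i j

/-- The bulk term `F(M)`. -/
def bulk (M : Matrix (Fin d) (Fin d) R) : Matrix (Fin d) (Fin d) R :=
  -(p.a • M) + p.b • (M * M - ((1 / (d : ℝ)) • (M * M).trace) • (1 : Matrix (Fin d) (Fin d) R))
    - (p.c • (M * M).trace) • M

/-- The derivative of `F` at `M` in the direction `B`. -/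
def bulkDeriv (M B : Matrix (Fin d) (Fin d) R) : Matrix (Fin d) (Fin d) R :=
  -(p.a • B)
    + p.b • (M * B + B * M - ((2 / (d : ℝ)) • (M * B).trace) • (1 : Matrix (Fin d) (Fin d) R))
    - ((2 * p.c) • (M * B).trace) • M - (p.c • (M * M).trace) • B

/-- The molecular field. -/
def mol (Q : Matrix (Fin d) (Fin d) R) : Matrix (Fin d) (Fin d) R :=
  p.L • C.laplaceM Q + bulk p Q

/-- The symmetric part of the gradient. -/
def symGrad (v : Fin d → R) : Matrix (Fin d) (Fin d) R :=
  (1 / 2 : ℝ) • (C.grad v + (C.grad v).transpose)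

/-- The skew part of the gradient. -/
def skewGrad (v : Fin d → R) : Matrix (Fin d) (Fin d) R :=
  (1 / 2 : ℝ) • (C.grad v - (C.grad v).transpose)

/-- `M + I / d`. -/
def shift (M : Matrix (Fin d) (Fin d) R) : Matrix (Fin d) (Fin d) R :=
  M + (1 / (d : ℝ)) • (1 : Matrix (Fin d) (Fin d) R)

/-- `S(∇v, Q)`. -/
def tumble (v : Fin d → R) (Q : Matrix (Fin d) (Fin d) R) : Matrix (Fin d) (Fin d) R :=
  (p.ξ • C.symGrad v + C.skewGrad v) * shift Q + shift Q * (p.ξ • C.symGrad v - C.skewGrad v)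
    - ((2 * p.ξ) • (Q * C.grad v).trace) • shift Q

/-- `∇Q ⊙ ∇Q`. -/
def odot (Q : Matrix (Fin d) (Fin d) R) : Matrix (Fin d) (Fin d) R :=
  Matrix.of fun i j => contract (C.derM i Q) (C.derM j Q)

/-- The symmetric stress `τ`. -/
def stressSym (Q : Matrix (Fin d) (Fin d) R) : Matrix (Fin d) (Fin d) R :=
  -(p.ξ • (shift Q * C.mol p Q)) - p.ξ • (C.mol p Q * shift Q)
    + ((2 * p.ξ) • (Q * C.mol p Q).trace) • shift Q - p.L • C.odot Q

/-- The skew stress `σ`. -/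
def stressSkew (Q : Matrix (Fin d) (Fin d) R) : Matrix (Fin d) (Fin d) R :=
  Q * C.mol p Q - C.mol p Q * Q

/-- The acceleration prescribed by the momentum equation. -/
def accel (v : Fin d → R) (P : R) (Q : Matrix (Fin d) (Fin d) R) : Fin d → R := fun i =>
  -(∑ k, v k * C.der k (v i)) + p.ν • C.laplace (v i) - C.der i P
    + p.lam • C.divM (C.stressSym p Q + C.stressSkew p Q) i

/-- The rate of change prescribed by the order parameter equation. -/
def rate (v : Fin d → R) (Q : Matrix (Fin d) (Fin d) R) : Matrix (Fin d) (Fin d) R :=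
  -C.advM v Q + C.tumble p v Q + p.Γ • C.mol p Q

/-- The rate of change of the molecular field when `Q` changes at rate `B`. -/
def molRate (Q B : Matrix (Fin d) (Fin d) R) : Matrix (Fin d) (Fin d) R :=
  p.L • C.laplaceM B + bulkDeriv p Q B

section Terms

variable (v : Fin d → R) (Q : Matrix (Fin d) (Fin d) R)

/-- The names `I1`, …, `I12` are the algebraic counterparts of `J1`, …, `J12`; `velA`, …, `molD` are
those of `velTermA`, …, `molTermD`. -/
def I1 : ℝ := C.int (∑ i, (∑ k, v k * C.der k (v i)) * C.laplace (v i))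

def I2 : ℝ := -2 * p.lam * C.int (∑ i, ∑ j, ∑ k, ∑ l,
  C.der l (v k) * C.der l (C.der k (Q i j)) * C.mol p Q i j)

def I3 : ℝ := p.lam / p.L * C.int (∑ i, ∑ j, ∑ k,
  v k * C.der k (bulk p Q i j) * C.mol p Q i j)

def I4 : ℝ := -2 * p.lam * C.int (∑ i, ∑ j, ∑ k, ∑ l,
  C.der j (v i) * (C.der l (Q k j) * C.der l (C.mol p Q i k)
    - C.der l (Q i k) * C.der l (C.mol p Q k j)))

def I5 : ℝ := -p.lam * C.int (∑ i, ∑ j, ∑ k,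
  C.der j (v i) * (C.laplaceM Q k j * C.mol p Q i k - C.laplaceM Q i k * C.mol p Q k j))

def I6 : ℝ := p.lam * p.ξ * C.int
  (contract (C.symGrad v * C.laplaceM Q + C.laplaceM Q * C.symGrad v) (C.mol p Q))

def I7 : ℝ := 4 * p.lam * p.ξ * C.int (∑ i, ∑ j, ∑ k, ∑ l,
  C.der l (C.symGrad v i k) * C.der l (Q k j) * C.mol p Q i j)

def I8 : ℝ := -2 * p.lam * p.ξ * C.int (∑ i, ∑ j, ∑ k, ∑ l,
  C.laplace (Q k l * Q j i) * C.der j (v i) * C.mol p Q k l)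

def I9 : ℝ := -4 * p.lam * p.ξ * C.int (∑ i, ∑ j, ∑ k, ∑ l, ∑ m,
  C.der m (Q k l * Q j i) * C.der m (C.der j (v i)) * C.mol p Q k l)

def I10 : ℝ := -(p.lam / p.L) * C.int (contract (bulkDeriv p Q (C.advM v Q)) (C.mol p Q))

def I11 : ℝ := p.lam / p.L * C.int (contract (bulkDeriv p Q (C.tumble p v Q)) (C.mol p Q))

def I12 : ℝ := p.lam / p.L * p.Γ * C.int (contract (bulkDeriv p Q (C.mol p Q)) (C.mol p Q))

def velA : ℝ := -p.lam * C.int (∑ i, C.divM (C.stressSkew p Q) i * C.laplace (v i))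

def molA : ℝ := p.lam * C.int (∑ i, ∑ j, ∑ k,
  C.der j (Q i k * C.mol p Q k j - Q k j * C.mol p Q i k) * C.laplace (v i))

def velB : ℝ := p.lam * p.L * C.int (∑ i, C.divM (C.odot Q) i * C.laplace (v i))

def molB : ℝ := -p.lam * C.int (∑ i, ∑ j, ∑ k,
  C.laplace (v k) * C.der k (Q i j) * C.mol p Q i j)

def velC : ℝ := p.lam * p.ξ * C.int (∑ i,
  C.divM (Q * C.mol p Q + C.mol p Q * Q + (2 / (d : ℝ)) • C.mol p Q) i * C.laplace (v i))

def molC : ℝ := p.lam * p.ξ * C.int (contract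
  (C.laplaceM (C.symGrad v) * Q + Q * C.laplaceM (C.symGrad v)
    + (2 / (d : ℝ)) • C.laplaceM (C.symGrad v)) (C.mol p Q))

def velD : ℝ := -2 * p.lam * p.ξ * C.int (∑ i,
  C.divM (contract Q (C.mol p Q) • shift Q) i * C.laplace (v i))

def molD : ℝ := 2 * p.lam * p.ξ * C.int (∑ i,
  C.divM (contract Q (C.mol p Q) • Q) i * C.laplace (v i))

end Terms

/-! ### Traces and symmetry -/

lemma contract_eq_trace {R : Type*} [CommRing R] {B : Matrix (Fin d) (Fin d) R} (hB : B.IsSymm)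
    (A : Matrix (Fin d) (Fin d) R) : contract A B = (A * B).trace := by
  simp only [contract, Matrix.trace, Matrix.diag, Matrix.mul_apply]
  exact Finset.sum_congr rfl fun i _ => Finset.sum_congr rfl fun j _ => by rw [hB.apply]

lemma isSymm_derM {A : Matrix (Fin d) (Fin d) R} (hA : A.IsSymm) (k : Fin d) :
    (C.derM k A).IsSymm := by
  rw [Matrix.IsSymm, ← derM_transpose, hA.eq]

lemma isSymm_laplaceM {A : Matrix (Fin d) (Fin d) R} (hA : A.IsSymm) :
    (C.laplaceM A).IsSymm := by
  rw [Matrix.IsSymm, ← laplaceM_transpose, hA.eq]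

lemma isSymm_bulk {Q : Matrix (Fin d) (Fin d) R} (hQ : Q.IsSymm) : (bulk p Q).IsSymm := by
  simp only [Matrix.IsSymm, bulk, Matrix.transpose_add, Matrix.transpose_sub,
    Matrix.transpose_smul, Matrix.transpose_neg, Matrix.transpose_mul, Matrix.transpose_one, hQ.eq]

lemma isSymm_mol {Q : Matrix (Fin d) (Fin d) R} (hQ : Q.IsSymm) : (C.mol p Q).IsSymm :=
  ((C.isSymm_laplaceM hQ).smul _).add (isSymm_bulk p hQ)

/-- The coefficient `1/d` is chosen so that the multiple of the identity removes exactly `tr(Q²)`;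
this needs `d ≠ 0`. -/
lemma trace_bulk (hd : d ≠ 0) {Q : Matrix (Fin d) (Fin d) R} (hQ : Q.trace = 0) :
    (bulk p Q).trace = 0 := by
  have : ((1 / (d : ℝ)) • (Q * Q).trace) * (d : R) = (Q * Q).trace := by
    rw [smul_mul_assoc, mul_comm, ← nsmul_eq_mul, ← Nat.cast_smul_eq_nsmul ℝ, smul_smul,
      one_div_mul_cancel (by exact_mod_cast hd), one_smul]
  rw [smul_mul_assoc, one_div] at this
  simp [bulk, Matrix.trace_add, Matrix.trace_sub, Matrix.trace_smul, hQ, smul_eq_mul, this]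

lemma trace_mol (hd : d ≠ 0) {Q : Matrix (Fin d) (Fin d) R} (hQ : Q.trace = 0) :
    (C.mol p Q).trace = 0 := by
  rw [mol, Matrix.trace_add, Matrix.trace_smul, ← laplace_trace, hQ, trace_bulk p hd hQ]
  simp

/-- Contraction with a symmetric matrix only sees the gradient through a commutator. -/
lemma trace_skew_commutator {M H : Matrix (Fin d) (Fin d) R} (hM : M.IsSymm) (hH : H.IsSymm)
    (G : Matrix (Fin d) (Fin d) R) :
    (((1 / 2 : ℝ) • (G - G.transpose) * M - M * (1 / 2 : ℝ) • (G - G.transpose)) * H).trace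
      = (G * (M * H - H * M)).trace := by
  -- Transposing under the trace replaces `Gᵀ` by `G` and reverses the order of the symmetric
  -- factors.
  have h1 : (G.transpose * (M * H)).trace = (G * (H * M)).trace := by
    rw [← Matrix.trace_transpose, Matrix.transpose_mul, Matrix.transpose_mul, hM.eq, hH.eq,
      Matrix.transpose_transpose, Matrix.trace_mul_comm]
  have h2 : (G.transpose * (H * M)).trace = (G * (M * H)).trace := by
    rw [← Matrix.trace_transpose, Matrix.transpose_mul, Matrix.transpose_mul, hM.eq, hH.eq,
      Matrix.transpose_transpose, Matrix.trace_mul_comm]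
  have h3 : ∀ X : Matrix (Fin d) (Fin d) R, (M * X * H).trace = (X * (H * M)).trace := fun X => by
    rw [Matrix.mul_assoc, Matrix.trace_mul_comm, Matrix.mul_assoc]
  simp only [Matrix.sub_mul, Matrix.mul_sub, Matrix.smul_mul, Matrix.mul_smul, Matrix.trace_sub,
    Matrix.trace_smul, smul_sub, h3]
  simp only [Matrix.mul_assoc, h1, h2]
  -- The halves from `Ω` recombine because each trace now occurs twice.
  have h4 : ∀ a : R, (1 / 2 : ℝ) • a + (1 / 2 : ℝ) • a = a := fun a => by
    rw [← add_smul]; norm_num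
  conv_rhs => rw [← h4 (G * (M * H)).trace, ← h4 (G * (H * M)).trace]
  abel

/-! ### The balance of the velocity gradient -/

lemma divM_add (A B : Matrix (Fin d) (Fin d) R) (i : Fin d) :
    C.divM (A + B) i = C.divM A i + C.divM B i := by
  simp [divM, Finset.sum_add_distrib]

lemma divM_sub (A B : Matrix (Fin d) (Fin d) R) (i : Fin d) :
    C.divM (A - B) i = C.divM A i - C.divM B i := by
  simp [divM, Finset.sum_sub_distrib]

lemma divM_smul (r : ℝ) (A : Matrix (Fin d) (Fin d) R) (i : Fin d) :
    C.divM (r • A) i = r • C.divM A i := by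
  simp [divM, Finset.smul_sum]

/-- Sorts the stress by cancelling pair. The two identity parts `H/d` of the shifted products merge
into `(2/d) H`. -/
lemma stress_eq {Q : Matrix (Fin d) (Fin d) R} (hQ : Q.IsSymm) :
    C.stressSym p Q + C.stressSkew p Q
      = C.stressSkew p Q - p.L • C.odot Q
        - p.ξ • (Q * C.mol p Q + C.mol p Q * Q + (2 / (d : ℝ)) • C.mol p Q)
        + (2 * p.ξ) • (contract Q (C.mol p Q) • shift Q) := by
  rw [contract_eq_trace (C.isSymm_mol p hQ)]
  simp only [stressSym, smul_assoc]
  simp only [shift, Matrix.add_mul, Matrix.mul_add, Matrix.smul_mul, Matrix.mul_smul,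
    Matrix.one_mul, Matrix.mul_one]
  rw [show (2 / (d : ℝ)) = 1 / (d : ℝ) + 1 / (d : ℝ) by ring, two_mul]
  module

theorem gradient_balance {v : Fin d → R} (P : R) {Q : Matrix (Fin d) (Fin d) R}
    (hv : C.div v = 0) (hQ : Q.IsSymm) :
    C.int (∑ i, ∑ j, C.der j (v i) * C.der j (C.accel p v P Q i))
        + p.ν * C.int (∑ i, C.laplace (v i) ^ 2)
      = C.I1 v + C.velA p v Q + C.velB p v Q + C.velC p v Q + C.velD p v Q := by
  have hP := C.int_der_mul_eq_zero P (C.div_laplace hv)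
  rw [int_grad_mul_grad]
  have key : ∑ i, C.laplace (v i) * C.accel p v P Q i
      = -∑ i, (∑ k, v k * C.der k (v i)) * C.laplace (v i)
        + p.ν • ∑ i, C.laplace (v i) ^ 2 - ∑ i, C.der i P * C.laplace (v i)
        + p.lam • ∑ i, C.divM (C.stressSkew p Q) i * C.laplace (v i)
        - (p.lam * p.L) • ∑ i, C.divM (C.odot Q) i * C.laplace (v i)
        - (p.lam * p.ξ) • ∑ i, C.divM (Q * C.mol p Q + C.mol p Q * Q
            + (2 / (d : ℝ)) • C.mol p Q) i * C.laplace (v i)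
        + (2 * p.lam * p.ξ) • ∑ i, C.divM (contract Q (C.mol p Q) • shift Q) i
            * C.laplace (v i) := by
    simp only [Finset.smul_sum, ← Finset.sum_add_distrib, ← Finset.sum_sub_distrib,
      ← Finset.sum_neg_distrib]
    refine Finset.sum_congr rfl fun i _ => ?_
    rw [accel, C.stress_eq p hQ]
    -- Freezing these two stresses keeps the divergence rules from breaking them up, so each matches
    -- its `velC` or `velD` integrand.
    generalize Q * C.mol p Q + C.mol p Q * Q + (2 / (d : ℝ)) • C.mol p Q = M
    generalize contract Q (C.mol p Q) • shift Q = N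
    simp only [divM_add, divM_sub, divM_smul]
    simp only [Algebra.smul_def, map_mul]
    ring
  rw [key]
  simp only [map_add, map_sub, map_neg, map_smul, hP, smul_eq_mul, I1, velA, velB, velC, velD]
  ring

/-! ### Index expressions as traces -/

lemma sum_comm_three {M : Type*} [AddCommMonoid M] (f : Fin d → Fin d → Fin d → M) :
    ∑ i, ∑ j, ∑ k, f i j k = ∑ k, ∑ i, ∑ j, f i j k := by
  simp_rw [Finset.sum_comm (s := Finset.univ) (t := Finset.univ) (f := fun j k => f _ j k)]
  rw [Finset.sum_comm]

lemma sum_comm_four {M : Type*} [AddCommMonoid M] (f : Fin d → Fin d → Fin d → Fin d → M) :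
    ∑ i, ∑ j, ∑ k, ∑ l, f i j k l = ∑ l, ∑ i, ∑ j, ∑ k, f i j k l := by
  simp_rw [sum_comm_three (fun j k l => f _ j k l)]
  rw [Finset.sum_comm]

lemma sum_comm_pairs {M : Type*} [AddCommMonoid M] (f : Fin d → Fin d → Fin d → Fin d → M) :
    ∑ i, ∑ j, ∑ k, ∑ l, f i j k l = ∑ k, ∑ l, ∑ i, ∑ j, f i j k l := by
  rw [sum_comm_four, sum_comm_four]

/-- The commutator expression of the skew stress, written out in indices. -/
lemma trace_commutator {R : Type*} [CommRing R] {M H : Matrix (Fin d) (Fin d) R} (hM : M.IsSymm)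
    (hH : H.IsSymm) (G : Matrix (Fin d) (Fin d) R) :
    (G * (M * H - H * M)).trace
      = ∑ i, ∑ j, ∑ k, G i j * (M k j * H i k - M i k * H k j) := by
  simp only [Matrix.trace, Matrix.diag, Matrix.mul_apply, Matrix.sub_apply,
    ← Finset.sum_sub_distrib, Finset.mul_sum]
  refine Finset.sum_congr rfl fun i _ => Finset.sum_congr rfl fun j _ =>
    Finset.sum_congr rfl fun k _ => ?_
  rw [hM.apply j k, hH.apply k i, hM.apply k i, hH.apply j k]
  ring

section

variable (v : Fin d → R) {Q : Matrix (Fin d) (Fin d) R}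

lemma I2_eq (hQ : Q.IsSymm) : C.I2 p v Q = -2 * p.lam * C.int (∑ k, ∑ l,
    C.der l (v k) * (C.derM l (C.derM k Q) * C.mol p Q).trace) := by
  simp only [I2, ← contract_eq_trace (C.isSymm_mol p hQ), contract, Finset.mul_sum]
  rw [sum_comm_pairs]
  simp only [derM_apply, mul_assoc]

lemma I3_eq (hQ : Q.IsSymm) : C.I3 p v Q = p.lam / p.L * C.int (∑ k,
    v k * (C.derM k (bulk p Q) * C.mol p Q).trace) := by
  simp only [I3, ← contract_eq_trace (C.isSymm_mol p hQ), contract, Finset.mul_sum]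
  rw [sum_comm_three]
  simp only [derM_apply, mul_assoc]

lemma molB_eq (hQ : Q.IsSymm) : C.molB p v Q = -p.lam * C.int (∑ k,
    C.laplace (v k) * (C.derM k Q * C.mol p Q).trace) := by
  simp only [molB, ← contract_eq_trace (C.isSymm_mol p hQ), contract, Finset.mul_sum]
  rw [sum_comm_three]
  simp only [derM_apply, mul_assoc]

lemma I4_eq (hQ : Q.IsSymm) : C.I4 p v Q = -2 * p.lam * ∑ l, C.intTr (C.grad v *
    (C.derM l Q * C.derM l (C.mol p Q) - C.derM l (C.mol p Q) * C.derM l Q)) := by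
  have hH := C.isSymm_mol p hQ
  simp only [intTr_apply, trace_commutator (C.isSymm_derM hQ _) (C.isSymm_derM hH _), ← map_sum]
  rw [I4, sum_comm_four]
  rfl

lemma I5_eq (hQ : Q.IsSymm) : C.I5 p v Q = -p.lam * C.intTr (C.grad v *
    (C.laplaceM Q * C.mol p Q - C.mol p Q * C.laplaceM Q)) := by
  rw [intTr_apply, trace_commutator (C.isSymm_laplaceM hQ) (C.isSymm_mol p hQ)]
  rfl

lemma isSymm_symGrad : (C.symGrad v).IsSymm := by
  simp [Matrix.IsSymm, symGrad, add_comm]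

lemma I6_eq (hQ : Q.IsSymm) : C.I6 p v Q = p.lam * p.ξ * C.intTr
    ((C.symGrad v * C.laplaceM Q + C.laplaceM Q * C.symGrad v) * C.mol p Q) := by
  rw [I6, contract_eq_trace (C.isSymm_mol p hQ), intTr_apply]

lemma I7_eq (hQ : Q.IsSymm) : C.I7 p v Q = 4 * p.lam * p.ξ * ∑ l, C.intTr
    (C.derM l (C.symGrad v) * C.derM l Q * C.mol p Q) := by
  simp only [intTr_apply, ← contract_eq_trace (C.isSymm_mol p hQ), contract, ← map_sum]
  rw [I7, sum_comm_four]
  simp only [Matrix.mul_apply, derM_apply, Finset.sum_mul]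

lemma molC_eq (hQ : Q.IsSymm) : C.molC p v Q = p.lam * p.ξ * C.intTr
    ((C.laplaceM (C.symGrad v) * Q + Q * C.laplaceM (C.symGrad v)
      + (2 / (d : ℝ)) • C.laplaceM (C.symGrad v)) * C.mol p Q) := by
  rw [molC, contract_eq_trace (C.isSymm_mol p hQ), intTr_apply]

/-- Up to commuting scalar factors, the integrand of `molA` is already that of `velA`; no
integration by parts is needed. -/
lemma molA_eq_divM : C.molA p v Q
    = p.lam * C.int (∑ i, C.divM (C.stressSkew p Q) i * C.laplace (v i)) := by
  simp only [molA, divM, stressSkew, Matrix.sub_apply, Matrix.mul_apply, map_sub, map_sum,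
    Finset.sum_mul, ← Finset.sum_sub_distrib, mul_comm (C.mol p Q _ _)]

/-- Two signs cancel: one from the integration by parts, one from the antisymmetry of the commutator
under transposition. -/
lemma molA_eq (hQ : Q.IsSymm) : C.molA p v Q = p.lam * C.intTr
    (C.laplaceM (C.grad v) * (Q * C.mol p Q - C.mol p Q * Q)) := by
  have hH := C.isSymm_mol p hQ
  rw [molA_eq_divM, int_divM_mul, grad_laplace, intTr_apply, ← Matrix.trace_transpose,
    Matrix.transpose_mul, Matrix.transpose_transpose, stressSkew, Matrix.transpose_sub,
    Matrix.transpose_mul, Matrix.transpose_mul, hQ.eq, hH.eq, ← map_neg, ← Matrix.trace_neg,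
    ← mul_neg, neg_sub, intTr_apply]

lemma molD_eq (hQ : Q.IsSymm) : C.molD p v Q = -2 * p.lam * p.ξ *
    C.int ((Q * C.laplaceM (C.grad v)).trace * (Q * C.mol p Q).trace) := by
  have h : (Q * (C.laplaceM (C.grad v)).transpose).trace = (Q * C.laplaceM (C.grad v)).trace := by
    rw [← Matrix.trace_transpose, Matrix.transpose_mul, Matrix.transpose_transpose, hQ.eq,
      Matrix.trace_mul_comm]
  rw [molD, int_divM_mul, grad_laplace, contract_eq_trace (C.isSymm_mol p hQ), intTr_apply,
    Matrix.smul_mul, Matrix.trace_smul, smul_eq_mul, h, mul_comm (Q * C.mol p Q).trace]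
  ring

/-- The terms carrying `ξ tr (Q ∇v)`. -/
lemma I8_add_I9_add_molD (hQ : Q.IsSymm) : C.I8 p v Q + C.I9 p v Q + C.molD p v Q
    = -2 * p.lam * p.ξ * C.intTr (C.laplaceM ((Q * C.grad v).trace • Q) * C.mol p Q) := by
  have hH := C.isSymm_mol p hQ
  -- Leibniz for `Δ` applied to `(Q_kl Q_ji) · ∇_j u_i`: both derivatives on the `Q` factors give
  -- `J8`, one on each side gives `J9`, both on `∇u` give `Y_d`.
  have key : (C.laplaceM ((Q * C.grad v).trace • Q) * C.mol p Q).trace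
      = (∑ i, ∑ j, ∑ k, ∑ l, C.laplace (Q k l * Q j i) * C.der j (v i) * C.mol p Q k l)
        + (2 : ℝ) • (∑ i, ∑ j, ∑ k, ∑ l, ∑ m,
          C.der m (Q k l * Q j i) * C.der m (C.der j (v i)) * C.mol p Q k l)
        + (Q * C.laplaceM (C.grad v)).trace * (Q * C.mol p Q).trace := by
    have h1 : ∀ k l, C.laplaceM ((Q * C.grad v).trace • Q) k l * C.mol p Q k l
        = ∑ i, ∑ j, (C.laplace (Q k l * Q j i) * C.der j (v i) * C.mol p Q k l
          + (2 : ℝ) • (∑ m, C.der m (Q k l * Q j i) * C.der m (C.der j (v i)) * C.mol p Q k l)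
          + Q k l * Q j i * C.laplace (C.der j (v i)) * C.mol p Q k l) := fun k l => by
      have : ((Q * C.grad v).trace • Q) k l = ∑ i, ∑ j, Q k l * Q j i * C.der j (v i) := by
        rw [Matrix.smul_apply, smul_eq_mul, Matrix.trace_mul_comm, mul_comm]
        simp only [Matrix.trace, Matrix.diag, Matrix.mul_apply, Finset.mul_sum, grad_apply]
        refine Finset.sum_congr rfl fun i _ => Finset.sum_congr rfl fun j _ => ?_
        ring
      rw [laplaceM_apply, this]
      simp only [map_sum, Finset.sum_mul]
      refine Finset.sum_congr rfl fun i _ => Finset.sum_congr rfl fun j _ => ?_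
      rw [laplace_mul, add_mul, add_mul, smul_mul_assoc, Finset.sum_mul]
    have h2 : (Q * C.laplaceM (C.grad v)).trace * (Q * C.mol p Q).trace
        = ∑ i, ∑ j, ∑ k, ∑ l, Q k l * Q j i * C.laplace (C.der j (v i)) * C.mol p Q k l := by
      rw [Matrix.trace_mul_comm, ← contract_eq_trace hH Q]
      simp only [contract, Matrix.trace, Matrix.diag, Matrix.mul_apply, grad_apply,
        laplaceM_apply]
      rw [Finset.sum_mul]
      refine Finset.sum_congr rfl fun i _ => ?_
      rw [Finset.sum_mul]
      refine Finset.sum_congr rfl fun j _ => ?_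
      rw [Finset.mul_sum]
      refine Finset.sum_congr rfl fun k _ => ?_
      rw [Finset.mul_sum]
      refine Finset.sum_congr rfl fun l _ => ?_
      ring
    rw [← contract_eq_trace hH, contract, h2]
    simp only [h1]
    rw [sum_comm_pairs]
    simp only [Finset.smul_sum, ← Finset.sum_add_distrib]
  rw [intTr_apply, key, molD_eq C p v hQ, I8, I9, map_add, map_add, map_smul, smul_eq_mul]
  ring

end

variable (v : Fin d → R) {Q : Matrix (Fin d) (Fin d) R}

/-! ### The balance of the molecular field -/

/-- Separates rotation, strain and trace terms. The identity in `Q + I/d` commutes with `Ω`, so it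
contributes only strain and trace. -/
lemma tumble_eq (Q : Matrix (Fin d) (Fin d) R) : C.tumble p v Q
    = (C.skewGrad v * Q - Q * C.skewGrad v) + p.ξ • (C.symGrad v * Q + Q * C.symGrad v)
      + (2 / (d : ℝ) * p.ξ) • C.symGrad v - (2 * p.ξ) • ((Q * C.grad v).trace • Q)
      - ((2 / (d : ℝ) * p.ξ) • (Q * C.grad v).trace) • (1 : Matrix (Fin d) (Fin d) R) := by
  rw [show (2 / (d : ℝ)) = 1 / (d : ℝ) + 1 / (d : ℝ) by ring]
  simp only [tumble, shift, Matrix.add_mul, Matrix.mul_add, Matrix.mul_sub,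
    Matrix.smul_mul, Matrix.mul_smul, Matrix.one_mul, Matrix.mul_one, smul_assoc, two_mul]
  module

/-- The rotational part of the corotational derivative. -/
lemma intTr_laplaceM_skew (hQ : Q.IsSymm) :
    p.lam * C.intTr (C.laplaceM (C.skewGrad v * Q - Q * C.skewGrad v) * C.mol p Q)
      = C.molA p v Q + C.I4 p v Q + C.I5 p v Q := by
  have hH := C.isSymm_mol p hQ
  rw [molA_eq C p v hQ, I4_eq C p v hQ, I5_eq C p v hQ]
  set H := C.mol p Q
  set G := C.grad v with hG
  have hL : C.laplaceM (C.skewGrad v)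
      = (1 / 2 : ℝ) • (C.laplaceM G - (C.laplaceM G).transpose) := by
    rw [skewGrad, map_smul, map_sub, laplaceM_transpose]
  have hD : ∀ l, C.derM l (C.skewGrad v)
      = (1 / 2 : ℝ) • (C.derM l G - (C.derM l G).transpose) := fun l => by
    rw [skewGrad, map_smul, map_sub, derM_transpose]
  have e : C.laplaceM (C.skewGrad v * Q - Q * C.skewGrad v) * H
      = (C.laplaceM (C.skewGrad v) * Q - Q * C.laplaceM (C.skewGrad v)) * H
        + (2 : ℝ) • ∑ l, (C.derM l (C.skewGrad v) * C.derM l Q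
          - C.derM l Q * C.derM l (C.skewGrad v)) * H
        + (C.skewGrad v * C.laplaceM Q - C.laplaceM Q * C.skewGrad v) * H := by
    rw [map_sub, laplaceM_mul, laplaceM_mul, ← Finset.sum_mul, Finset.sum_sub_distrib]
    simp only [Matrix.add_mul, Matrix.sub_mul, Matrix.smul_mul, smul_sub]
    abel
  have h1 : C.intTr ((C.laplaceM (C.skewGrad v) * Q - Q * C.laplaceM (C.skewGrad v)) * H)
      = C.intTr (C.laplaceM G * (Q * H - H * Q)) := by
    rw [intTr_apply, hL, trace_skew_commutator hQ hH, intTr_apply]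
  -- Integrating by parts takes the derivative off `∇u`. The Leibniz factor `2` then gives `-2`
  -- copies of the `ΔQ` commutator against the single one from `h3`, whence the coefficients `-λ` in
  -- `J5` and `-2λ` in `J4`.
  have h2 : ∀ l, C.intTr ((C.derM l (C.skewGrad v) * C.derM l Q
        - C.derM l Q * C.derM l (C.skewGrad v)) * H)
      = -C.intTr (G * ((C.derM l (C.derM l Q) * H - H * C.derM l (C.derM l Q))))
        - C.intTr (G * (C.derM l Q * C.derM l H - C.derM l H * C.derM l Q)) := fun l => by
    rw [intTr_apply, hD, trace_skew_commutator (C.isSymm_derM hQ l) hH, ← intTr_apply,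
      intTr_derM_mul, map_sub, derM_mul, derM_mul, neg_eq_iff_eq_neg, neg_sub, sub_neg_eq_add,
      ← map_add, ← Matrix.mul_add]
    congr 2
    abel
  have h3 : C.intTr ((C.skewGrad v * C.laplaceM Q - C.laplaceM Q * C.skewGrad v) * H)
      = C.intTr (G * (C.laplaceM Q * H - H * C.laplaceM Q)) := by
    rw [intTr_apply, skewGrad, trace_skew_commutator (C.isSymm_laplaceM hQ) hH, intTr_apply]
  have h4 : ∑ l, C.intTr (G * ((C.derM l (C.derM l Q) * H - H * C.derM l (C.derM l Q))))
      = C.intTr (G * (C.laplaceM Q * H - H * C.laplaceM Q)) := by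
    rw [laplaceM_eq, ← map_sum, Finset.sum_mul, Finset.mul_sum, ← Finset.sum_sub_distrib,
      Finset.mul_sum]
  rw [e, map_add, map_add, map_smul, map_sum, h1, h3]
  simp only [h2, Finset.sum_sub_distrib, Finset.sum_neg_distrib, h4, smul_eq_mul]
  ring

/-- The strain part of the corotational derivative. -/
lemma intTr_laplaceM_sym (hQ : Q.IsSymm) :
    p.lam * C.intTr (C.laplaceM (p.ξ • (C.symGrad v * Q + Q * C.symGrad v)
        + (2 / (d : ℝ) * p.ξ) • C.symGrad v) * C.mol p Q)
      = C.molC p v Q + C.I6 p v Q + C.I7 p v Q := by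
  have hH := C.isSymm_mol p hQ
  rw [molC_eq C p v hQ, I6_eq C p v hQ, I7_eq C p v hQ]
  set H := C.mol p Q
  set D := C.symGrad v
  have hD : D.IsSymm := C.isSymm_symGrad v
  -- Transposition identifies the two cross terms, so the factor `2` of Leibniz becomes the `4` of
  -- `J7`.
  have h1 : ∀ l, C.intTr (C.derM l Q * C.derM l D * H)
      = C.intTr (C.derM l D * C.derM l Q * H) := fun l => by
    rw [intTr_apply, ← Matrix.trace_transpose, Matrix.transpose_mul, Matrix.transpose_mul, hH.eq,
      (C.isSymm_derM hQ l).eq, (C.isSymm_derM hD l).eq, Matrix.trace_mul_comm, intTr_apply]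
  have e : C.laplaceM (p.ξ • (D * Q + Q * D) + (2 / (d : ℝ) * p.ξ) • D) * H
      = p.ξ • ((C.laplaceM D * Q + Q * C.laplaceM D + (2 / (d : ℝ)) • C.laplaceM D) * H)
        + p.ξ • ((D * C.laplaceM Q + C.laplaceM Q * D) * H)
        + (2 * p.ξ) • (∑ l, C.derM l D * C.derM l Q * H + ∑ l, C.derM l Q * C.derM l D * H) := by
    simp only [map_add, map_smul, laplaceM_mul, ← Finset.sum_mul, Matrix.add_mul, Matrix.smul_mul]
    module
  rw [e, map_add, map_add, map_smul, map_smul, map_smul, map_add, map_sum, map_sum]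
  simp only [h1, smul_eq_mul]
  ring

lemma intTr_laplaceM_tumble (hd : d ≠ 0) (hQ : Q.IsSymm) (htr : Q.trace = 0) :
    p.lam * C.intTr (C.laplaceM (C.tumble p v Q) * C.mol p Q)
      = C.molA p v Q + C.molC p v Q + C.molD p v Q + C.I4 p v Q + C.I5 p v Q + C.I6 p v Q
        + C.I7 p v Q + C.I8 p v Q + C.I9 p v Q := by
  have h1 := C.intTr_laplaceM_skew p v hQ
  have h2 := C.intTr_laplaceM_sym p v hQ
  have h3 := C.I8_add_I9_add_molD p v hQ
  -- Multiples of the identity are invisible to the traceless `H`.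
  have h4 : ∀ f : R, C.intTr (C.laplaceM (f • (1 : Matrix (Fin d) (Fin d) R)) * C.mol p Q) = 0 := by
    intro f
    have : C.laplaceM (f • (1 : Matrix (Fin d) (Fin d) R))
        = C.laplace f • (1 : Matrix (Fin d) (Fin d) R) := by
      simp [laplaceM_smul, derM_one, C.laplaceM_eq 1]
    rw [this, Matrix.smul_mul, Matrix.one_mul, intTr_apply, Matrix.trace_smul,
      C.trace_mol p hd htr, smul_zero, map_zero]
  rw [tumble_eq, map_sub, map_sub, add_assoc, map_add, Matrix.sub_mul, Matrix.sub_mul,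
    Matrix.add_mul, map_sub, map_sub, map_add, h4, map_smul, Matrix.smul_mul, map_smul,
    smul_eq_mul]
  linear_combination h1 + h2 - h3

/-- Only the term with all of `Δ` on `∇Q` is delicate: writing `LΔQ = H - F` trades it for `u · ∇F :
H`. -/
lemma intTr_laplaceM_adv (hL : p.L ≠ 0) (hv : C.div v = 0) (hQ : Q.IsSymm) :
    -p.lam * C.intTr (C.laplaceM (C.advM v Q) * C.mol p Q)
      = C.molB p v Q + C.I2 p v Q + C.I3 p v Q := by
  rw [molB_eq C p v hQ, I2_eq C p v hQ, I3_eq C p v hQ]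
  -- The integrand is `u · ∇(½ tr H²)`, and `u` is divergence free.
  have h0 : C.int (∑ k, v k * (C.derM k (C.mol p Q) * C.mol p Q).trace) = 0 := by
    have h := C.int_der_mul_eq_zero ((1 / 2 : ℝ) • (C.mol p Q * C.mol p Q).trace) hv
    rw [← h]
    congr 1
    refine Finset.sum_congr rfl fun k _ => ?_
    rw [Derivation.map_smul, der_trace, derM_mul, Matrix.trace_add,
      Matrix.trace_mul_comm (C.mol p Q), ← two_smul ℝ, smul_smul, mul_comm]
    norm_num
  have h1 : C.int (∑ k, v k * (C.derM k (C.laplaceM Q) * C.mol p Q).trace)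
      = -(1 / p.L * C.int (∑ k, v k * (C.derM k (bulk p Q) * C.mol p Q).trace)) := by
    have : ∀ k, v k * (C.derM k (C.mol p Q) * C.mol p Q).trace
        = p.L • (v k * (C.derM k (C.laplaceM Q) * C.mol p Q).trace)
          + v k * (C.derM k (bulk p Q) * C.mol p Q).trace := fun k => by
      conv_lhs => enter [2, 1, 1]; rw [mol]
      rw [map_add, map_smul, Matrix.add_mul, Matrix.trace_add, Matrix.smul_mul,
        Matrix.trace_smul, mul_add, mul_smul_comm]
    simp only [this, Finset.sum_add_distrib, ← Finset.smul_sum, map_add, map_smul,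
      smul_eq_mul] at h0
    field_simp
    linarith
  have e : (C.laplaceM (C.advM v Q) * C.mol p Q).trace
      = ∑ k, C.laplace (v k) * (C.derM k Q * C.mol p Q).trace
        + (2 : ℝ) • ∑ k, ∑ l, C.der l (v k) * (C.derM l (C.derM k Q) * C.mol p Q).trace
        + ∑ k, v k * (C.derM k (C.laplaceM Q) * C.mol p Q).trace := by
    simp only [advM, map_sum, laplaceM_smul, Finset.sum_mul, Matrix.trace_sum, Finset.smul_sum,
      ← Finset.sum_add_distrib, Matrix.add_mul, Matrix.trace_add, Matrix.smul_mul,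
      Matrix.trace_smul, smul_eq_mul, derM_laplaceM]
  rw [intTr_apply, e, map_add, map_add, map_smul, smul_eq_mul, h1]
  ring

lemma bulkDeriv_add (Q A B : Matrix (Fin d) (Fin d) R) :
    bulkDeriv p Q (A + B) = bulkDeriv p Q A + bulkDeriv p Q B := by
  simp only [bulkDeriv, Matrix.mul_add, Matrix.add_mul, Matrix.trace_add, smul_add, add_smul]
  module

lemma bulkDeriv_smul (Q : Matrix (Fin d) (Fin d) R) (r : ℝ) (A : Matrix (Fin d) (Fin d) R) :
    bulkDeriv p Q (r • A) = r • bulkDeriv p Q A := by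
  simp only [bulkDeriv, Matrix.mul_smul, Matrix.smul_mul, Matrix.trace_smul, smul_assoc]
  module

lemma int_contract_laplaceM_self (A : Matrix (Fin d) (Fin d) R) (hA : A.IsSymm) :
    C.int (∑ k, contract (C.derM k A) (C.derM k A)) = -C.intTr (C.laplaceM A * A) := by
  rw [intTr_laplaceM_mul, neg_neg, map_sum]
  exact Finset.sum_congr rfl fun k _ => by
    rw [contract_eq_trace (C.isSymm_derM hA k), intTr_apply]

theorem mol_balance (hd : d ≠ 0) (hL : p.L ≠ 0) (hv : C.div v = 0) (hQ : Q.IsSymm)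
    (htr : Q.trace = 0) :
    p.lam / p.L * C.int (contract (C.molRate p Q (C.rate p v Q)) (C.mol p Q))
        + p.lam * p.Γ * C.int (∑ k, contract (C.derM k (C.mol p Q)) (C.derM k (C.mol p Q)))
      = C.molA p v Q + C.molB p v Q + C.molC p v Q + C.molD p v Q + C.I2 p v Q + C.I3 p v Q
        + C.I4 p v Q + C.I5 p v Q + C.I6 p v Q + C.I7 p v Q + C.I8 p v Q + C.I9 p v Q
        + C.I10 p v Q + C.I11 p v Q + C.I12 p Q := by
  have hH := C.isSymm_mol p hQ
  have h1 := C.intTr_laplaceM_tumble p v hd hQ htr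
  have h2 := C.intTr_laplaceM_adv p v hL hv hQ
  have e : C.rate p v Q = (-1 : ℝ) • C.advM v Q + C.tumble p v Q + p.Γ • C.mol p Q := by
    rw [rate, neg_one_smul]
  rw [C.int_contract_laplaceM_self _ hH, contract_eq_trace hH, ← intTr_apply, molRate, e,
    bulkDeriv_add, bulkDeriv_add, bulkDeriv_smul, bulkDeriv_smul, I10, I11, I12]
  simp only [contract_eq_trace hH, ← intTr_apply, map_add, map_smul, Matrix.add_mul,
    Matrix.smul_mul, smul_eq_mul]
  field_simp at h1 h2 ⊢
  linear_combination p.L * h1 + p.L * h2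

/-! ### The cancellations -/

lemma velA_add_molA : C.velA p v Q + C.molA p v Q = 0 := by
  rw [molA_eq_divM, velA]; ring

/-- The bulk term is the gradient of a potential along trace-free fields. -/
lemma trace_derM_mul_bulk (htr : Q.trace = 0) (i : Fin d) :
    (C.derM i Q * bulk p Q).trace = C.der i ((-p.a / 2) • (Q * Q).trace
      + (p.b / 3) • (Q * Q * Q).trace - (p.c / 4) • ((Q * Q).trace * (Q * Q).trace)) := by
  -- Removes the identity part of the `b`-term, which is not itself a gradient.
  have h0 : (C.derM i Q).trace = 0 := by rw [← der_trace, htr, map_zero]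
  have h2 : C.der i (Q * Q).trace = (2 : ℝ) • (C.derM i Q * Q).trace := by
    rw [der_trace, derM_mul, Matrix.trace_add, Matrix.trace_mul_comm Q, two_smul]
  have h3 : C.der i (Q * Q * Q).trace = (3 : ℝ) • (C.derM i Q * (Q * Q)).trace := by
    rw [der_trace, derM_mul, derM_mul, Matrix.add_mul, Matrix.trace_add, Matrix.trace_add,
      Matrix.trace_mul_cycle Q, Matrix.trace_mul_comm (Q * Q), Matrix.mul_assoc]
    module
  rw [map_sub, map_add, Derivation.map_smul, Derivation.map_smul, Derivation.map_smul, der_mul,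
    h2, h3, bulk]
  simp only [Matrix.mul_add, Matrix.mul_sub, Matrix.mul_neg, Matrix.mul_one, Matrix.trace_add,
    Matrix.trace_sub, Matrix.trace_neg, Matrix.trace_smul, h0, mul_zero, sub_zero,
    smul_eq_mul, smul_mul_assoc, mul_smul_comm, mul_comm (Q * Q).trace]
  module

/-- `∇·(∇Q ⊙ ∇Q)` is `∇(½|∇Q|²)` plus `∇Q : ΔQ`, and `L ∇Q : ΔQ` differs from `∇Q : H` by the
gradient `∇Q : F`. Gradients are orthogonal to `Δu`. -/
lemma velB_add_molB (hv : C.div v = 0) (hQ : Q.IsSymm) (htr : Q.trace = 0) :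
    C.velB p v Q + C.molB p v Q = 0 := by
  have hdiv : ∀ i, C.divM (C.odot Q) i
      = C.der i ((1 / 2 : ℝ) • ∑ k, (C.derM k Q * C.derM k Q).trace)
        + (C.derM i Q * C.laplaceM Q).trace := fun i => by
    rw [divM, Derivation.map_smul, map_sum, laplaceM_eq, Finset.mul_sum, Matrix.trace_sum,
      Finset.smul_sum, ← Finset.sum_add_distrib]
    refine Finset.sum_congr rfl fun k _ => ?_
    rw [odot, Matrix.of_apply, contract_eq_trace (C.isSymm_derM hQ k), der_trace, der_trace,
      derM_mul, derM_mul, Matrix.trace_add, Matrix.trace_add,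
      Matrix.trace_mul_comm (C.derM k Q) (C.derM i (C.derM k Q)), C.derM_comm k i]
    module
  have hw := C.div_laplace hv
  have h1 := C.int_der_mul_eq_zero ((1 / 2 : ℝ) • ∑ k, (C.derM k Q * C.derM k Q).trace) hw
  have h2 := C.int_der_mul_eq_zero ((-p.a / 2) • (Q * Q).trace
      + (p.b / 3) • (Q * Q * Q).trace - (p.c / 4) • ((Q * Q).trace * (Q * Q).trace)) hw
  simp only [← C.trace_derM_mul_bulk p htr] at h2
  rw [molB_eq C p v hQ, velB]
  simp only [hdiv, add_mul, Finset.sum_add_distrib, map_add, h1]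
  have h3 : ∀ k, C.laplace (v k) * (C.derM k Q * C.mol p Q).trace
      = p.L • ((C.derM k Q * C.laplaceM Q).trace * C.laplace (v k))
        + (C.derM k Q * bulk p Q).trace * C.laplace (v k) := fun k => by
    rw [mol, Matrix.mul_add, Matrix.mul_smul, Matrix.trace_add, Matrix.trace_smul, mul_comm,
      add_mul, smul_mul_assoc]
  simp only [h3, Finset.sum_add_distrib, ← Finset.smul_sum, map_add, h2, map_smul, smul_eq_mul]
  ring

/-- After integrating by parts, the symmetric matrix `QH + HQ + (2/d)H` pairs equally with `∇Δu` and
its transpose, hence with `ΔD`. -/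
lemma velC_add_molC (hQ : Q.IsSymm) : C.velC p v Q + C.molC p v Q = 0 := by
  have hH := C.isSymm_mol p hQ
  rw [molC_eq C p v hQ, velC, int_divM_mul, grad_laplace, symGrad, map_smul, map_add,
    laplaceM_transpose]
  set H := C.mol p Q
  set K := C.laplaceM (C.grad v)
  have hM : (Q * H + H * Q + (2 / (d : ℝ)) • H).IsSymm := by
    simp only [Matrix.IsSymm, Matrix.transpose_add, Matrix.transpose_smul, Matrix.transpose_mul,
      hQ.eq, hH.eq, add_comm]
  have h1 : ∀ D : Matrix (Fin d) (Fin d) R,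
      C.intTr ((D * Q + Q * D + (2 / (d : ℝ)) • D) * H)
        = C.intTr ((Q * H + H * Q + (2 / (d : ℝ)) • H) * D) := fun D => by
    simp only [Matrix.add_mul, Matrix.smul_mul, map_add, map_smul]
    rw [Matrix.mul_assoc D, C.intTr_mul_comm D (Q * H), Matrix.mul_assoc Q D,
      C.intTr_mul_comm Q (D * H), Matrix.mul_assoc D H, C.intTr_mul_comm D (H * Q),
      C.intTr_mul_comm D H]
  have h2 : C.intTr ((Q * H + H * Q + (2 / (d : ℝ)) • H) * K)
      = C.intTr ((Q * H + H * Q + (2 / (d : ℝ)) • H) * K.transpose) := by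
    rw [intTr_apply, ← Matrix.trace_transpose, Matrix.transpose_mul, hM.eq,
      Matrix.trace_mul_comm, intTr_apply]
  rw [h1, Matrix.mul_smul, map_smul, Matrix.mul_add, map_add, h2, smul_eq_mul]
  ring

/-- The two stresses differ by a scalar multiple of the identity, whose divergence is a gradient. -/
lemma velD_add_molD (hv : C.div v = 0) : C.velD p v Q + C.molD p v Q = 0 := by
  have h := C.int_der_mul_eq_zero ((1 / (d : ℝ)) • contract Q (C.mol p Q)) (C.div_laplace hv)
  have e : ∀ i, C.divM (contract Q (C.mol p Q) • shift Q) i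
      = C.divM (contract Q (C.mol p Q) • Q) i
        + C.der i ((1 / (d : ℝ)) • contract Q (C.mol p Q)) := fun i => by
    rw [shift, smul_add, divM_add]
    congr 1
    rw [divM, Finset.sum_eq_single i]
    · simp
    · intro j _ hj
      simp [Matrix.one_apply_ne hj.symm]
    · simp
  simp only [velD, molD, e, add_mul, Finset.sum_add_distrib, map_add, h]
  ring

end PeriodicCalculus

/-! ### Smooth periodic functions -/

/-- Second directional derivatives commute. -/
lemma fderiv_fderiv_comm {E : Type*} [NormedAddCommGroup E] [NormedSpace ℝ E] {f : E → ℝ} {x : E}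
    (hf : ContDiffAt ℝ ∞ f x) (a b : E) :
    fderiv ℝ (fun z => fderiv ℝ f z a) x b = fderiv ℝ (fun z => fderiv ℝ f z b) x a := by
  have hd : DifferentiableAt ℝ (fderiv ℝ f) x :=
    (hf.fderiv_right (m := 1) (by norm_cast)).differentiableAt one_ne_zero
  have h := hf.isSymmSndFDerivAt (by
    rw [minSmoothness_of_isRCLikeNormedField]; exact WithTop.coe_le_coe.2 le_top)
  rw [fderiv_clm_apply hd (differentiableAt_const _), fderiv_clm_apply hd (differentiableAt_const _)]
  simpa using h b a

lemma contDiff_pd {f : (Fin d → ℝ) → ℝ} (hf : ContDiff ℝ ∞ f) (k : Fin d) :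
    ContDiff ℝ ∞ (pd k f) :=
  (hf.fderiv_right (m := ∞) (by norm_cast)).clm_apply contDiff_const

lemma isPeriodic_pd {f : (Fin d → ℝ) → ℝ} (hf : IsPeriodic f) (k : Fin d) :
    IsPeriodic (pd k f) := by
  intro x l
  have h : (fun y => f (y + Pi.single l 1)) = f := funext fun y => hf y l
  rw [pd, ← fderiv_comp_add_right, h, pd]

/-- The algebra of smooth periodic functions. -/
def smoothPeriodic (d : ℕ) : Subalgebra ℝ ((Fin d → ℝ) → ℝ) where
  carrier := {f | ContDiff ℝ ∞ f ∧ IsPeriodic f}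
  mul_mem' := fun ⟨hf, hf'⟩ ⟨hg, hg'⟩ =>
    ⟨hf.mul hg, fun x k => by rw [Pi.mul_apply, Pi.mul_apply, hf', hg']⟩
  add_mem' := fun ⟨hf, hf'⟩ ⟨hg, hg'⟩ =>
    ⟨hf.add hg, fun x k => by rw [Pi.add_apply, Pi.add_apply, hf', hg']⟩
  algebraMap_mem' := fun r => ⟨contDiff_const, fun _ _ => rfl⟩

/-- Evaluation at a point. -/
def ev (x : Fin d → ℝ) : smoothPeriodic d →ₐ[ℝ] ℝ :=
  (Pi.evalAlgHom ℝ (fun _ : Fin d → ℝ => ℝ) x).comp (smoothPeriodic d).val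

lemma contDiff_ev (f : smoothPeriodic d) : ContDiff ℝ ∞ fun x => ev x f := f.2.1

lemma isPeriodic_ev (f : smoothPeriodic d) : IsPeriodic fun x => ev x f := f.2.2

lemma smoothPeriodic_ext {f g : smoothPeriodic d} (h : ∀ x, ev x f = ev x g) : f = g :=
  Subtype.ext (funext h)

/-- The partial derivative as a derivation. -/
def partialDer (k : Fin d) : Derivation ℝ (smoothPeriodic d) (smoothPeriodic d) :=
  Derivation.mk'
    { toFun := fun f => ⟨pd k f, contDiff_pd f.2.1 k, isPeriodic_pd f.2.2 k⟩
      map_add' := fun f g => Subtype.ext (funext fun x => by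
        have hf := f.2.1.differentiable (by simp) x
        have hg := g.2.1.differentiable (by simp) x
        change fderiv ℝ (f.1 + g.1) x _ = fderiv ℝ f.1 x _ + fderiv ℝ g.1 x _
        rw [fderiv_add hf hg, _root_.add_apply])
      map_smul' := fun c f => Subtype.ext (funext fun x => by
        have hf := f.2.1.differentiable (by simp) x
        change fderiv ℝ (c • f.1) x _ = c * fderiv ℝ f.1 x _
        rw [fderiv_const_smul hf, _root_.smul_apply, smul_eq_mul]) }
    fun f g => Subtype.ext (funext fun x => by
      have hf := f.2.1.differentiable (by simp) x
      have hg := g.2.1.differentiable (by simp) x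
      change fderiv ℝ (f.1 * g.1) x _ = f.1 x * fderiv ℝ g.1 x _ + g.1 x * fderiv ℝ f.1 x _
      rw [fderiv_mul hf hg, _root_.add_apply, _root_.smul_apply,
        _root_.smul_apply, smul_eq_mul, smul_eq_mul])

lemma integrableOn_cell {f : (Fin d → ℝ) → ℝ} (hf : Continuous f) :
    MeasureTheory.IntegrableOn f (Set.Icc (0 : Fin d → ℝ) 1) :=
  hf.continuousOn.integrableOn_compact isCompact_Icc

/-- The integral over the cell as a linear functional. -/
def cellIntL (d : ℕ) : smoothPeriodic d →ₗ[ℝ] ℝ where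
  toFun f := cellInt fun x => ev x f
  map_add' f g := by
    simp only [map_add, cellInt]
    exact MeasureTheory.integral_add (integrableOn_cell (contDiff_ev f).continuous)
      (integrableOn_cell (contDiff_ev g).continuous)
  map_smul' c f := by
    simp only [map_smul, cellInt, smul_eq_mul, RingHom.id_apply]
    exact MeasureTheory.integral_const_mul _ _

/-- The integral of a derivative of a periodic function over the cell vanishes. -/
lemma cellInt_pd {f : (Fin d → ℝ) → ℝ} (hf : ContDiff ℝ ∞ f) (hp : IsPeriodic f) (k : Fin d) :
    cellInt (pd k f) = 0 := by
  -- There is no direction `k` when `d = 0`; the divergence theorem below is stated in dimension `n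
  -- + 1`.
  obtain _ | n := d
  · exact k.elim0
  have hdiff : Differentiable ℝ f := hf.differentiable (by simp)
  -- Applied to the field `f e_k`, whose divergence is `∂_k f`.
  have h := MeasureTheory.integral_divergence_of_hasFDerivAt_off_countable'
    (0 : Fin (n + 1) → ℝ) 1 zero_le_one (fun i => if i = k then f else 0)
    (fun i x => if i = k then fderiv ℝ f x else 0) ∅ Set.countable_empty
    (fun i => by
      split_ifs
      · exact hf.continuous.continuousOn
      · exact continuousOn_const)
    (fun x _ i => by
      split_ifs
      · exact (hdiff x).hasFDerivAt
      · exact hasFDerivAt_const _ _)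
    (by
      have : (fun x => ∑ i, (if i = k then fderiv ℝ f x else 0) (Pi.single i 1)) = pd k f := by
        funext x
        rw [Finset.sum_eq_single k (fun i _ hi => by simp [hi]) (by simp)]
        simp [pd]
      rw [this]
      exact integrableOn_cell (contDiff_pd hf k).continuous)
  have e : ∀ x, ∑ i, (if i = k then fderiv ℝ f x else 0) (Pi.single i 1) = pd k f x := fun x => by
    rw [Finset.sum_eq_single k (fun i _ hi => by simp [hi]) (by simp)]
    simp [pd]
  simp only [e] at h
  rw [cellInt, h]
  refine Finset.sum_eq_zero fun i _ => ?_
  by_cases hi : i = k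
  · subst hi
    rw [sub_eq_zero]
    refine MeasureTheory.setIntegral_congr_fun measurableSet_Icc fun y _ => ?_
    -- Opposite faces differ by one period, so their contributions cancel.
    have hy := hp (i.insertNth 0 y) i
    have : (i.insertNth (0 : ℝ) y : Fin (n + 1) → ℝ) + Pi.single i 1 = i.insertNth 1 y := by
      ext j
      refine Fin.succAboveCases i ?_ (fun j => ?_) j <;> simp
    rw [this] at hy
    simpa using hy
  · simp [hi]

/-- The calculus of smooth periodic functions. -/
def boxCalculus (d : ℕ) : PeriodicCalculus d (smoothPeriodic d) where
  der := partialDer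
  der_comm k l f := smoothPeriodic_ext fun _ =>
    fderiv_fderiv_comm (f.2.1.contDiffAt) (Pi.single l 1) (Pi.single k 1)
  int := cellIntL d
  int_der k f := cellInt_pd (contDiff_ev f) (isPeriodic_ev f) k

/-! ### The fields of the system as elements of the algebra of smooth periodic functions -/

/-- The vector field with given smooth periodic components. -/
def vecField (V : Fin d → smoothPeriodic d) : (Fin d → ℝ) → Fin d → ℝ := fun x i => ev x (V i)

/-- The matrix field with given smooth periodic entries. -/
def matField (A : Matrix (Fin d) (Fin d) (smoothPeriodic d)) :
    (Fin d → ℝ) → Matrix (Fin d) (Fin d) ℝ :=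
  fun x => A.map (ev x)

@[simp] lemma vecField_apply (V : Fin d → smoothPeriodic d) (x : Fin d → ℝ) (i : Fin d) :
    vecField V x i = ev x (V i) := rfl

@[simp] lemma matField_apply (A : Matrix (Fin d) (Fin d) (smoothPeriodic d)) (x : Fin d → ℝ)
    (i j : Fin d) : matField A x i j = ev x (A i j) := rfl

section MatField

variable (A B : Matrix (Fin d) (Fin d) (smoothPeriodic d)) (x : Fin d → ℝ)

lemma matField_add : matField (A + B) x = matField A x + matField B x := by ext; simp

lemma matField_sub : matField (A - B) x = matField A x - matField B x := by ext; simp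

lemma matField_neg : matField (-A) x = -matField A x := by ext; simp

lemma matField_mul : matField (A * B) x = matField A x * matField B x := by
  ext; simp [Matrix.mul_apply]

lemma matField_one : matField (1 : Matrix (Fin d) (Fin d) (smoothPeriodic d)) x = 1 :=
  Matrix.map_one _ (map_zero _) (map_one _)

lemma matField_smul (r : ℝ) : matField (r • A) x = r • matField A x := by ext; simp

lemma matField_smul' (f : smoothPeriodic d) : matField (f • A) x = ev x f • matField A x := by
  ext; simp

lemma matField_transpose : matField A.transpose x = (matField A x).transpose := rfl

lemma ev_trace : ev x A.trace = (matField A x).trace := by simp [Matrix.trace]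

lemma ev_contract : ev x (PeriodicCalculus.contract A B) = frob (matField A x) (matField B x) := by
  simp [PeriodicCalculus.contract, frob]

end MatField

/-! ### The differential operators -/

section Operators

variable (p : Params) (V : Fin d → smoothPeriodic d)
  (A B : Matrix (Fin d) (Fin d) (smoothPeriodic d)) (f : smoothPeriodic d) (x : Fin d → ℝ)

lemma pd_ev (k : Fin d) : pd k (fun y => ev y f) = fun y => ev y ((boxCalculus d).der k f) := rfl

lemma pd_ev_mul (g : smoothPeriodic d) (k : Fin d) :
    pd k (fun y => ev y f * ev y g) = fun y => ev y ((boxCalculus d).der k (f * g)) := rfl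

lemma lap_ev : lap (fun y => ev y f) x = ev x ((boxCalculus d).laplace f) := by
  simp only [lap, pd_ev, PeriodicCalculus.laplace_apply, map_sum]

lemma lapVec_vecField :
    lapVec (vecField V) = vecField fun i => (boxCalculus d).laplace (V i) := by
  funext x i; exact lap_ev (V i) x

lemma lapMat_matField : lapMat (matField A) = matField ((boxCalculus d).laplaceM A) := by
  funext x; ext i j; exact lap_ev (A i j) x

lemma pdMat_matField (k : Fin d) :
    pdMat k (matField A) = matField ((boxCalculus d).derM k A) := rfl

lemma divVec_vecField : divVec (vecField V) x = ev x ((boxCalculus d).div V) := by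
  simp only [divVec, PeriodicCalculus.div, map_sum, vecField_apply, pd_ev]

lemma divMat_matField : divMat (matField A) = vecField ((boxCalculus d).divM A) := by
  funext x i
  simp only [divMat, PeriodicCalculus.divM, map_sum, vecField_apply, matField_apply, pd_ev]

lemma advVec_vecField : advVec (vecField V) (vecField V)
    = vecField fun i => ∑ k, V k * (boxCalculus d).der k (V i) := by
  funext x i
  simp only [advVec, map_sum, map_mul, vecField_apply, pd_ev]

lemma advMat_matField :
    advMat (vecField V) (matField A) = matField ((boxCalculus d).advM V A) := by
  funext x
  ext i j
  simp [advMat, PeriodicCalculus.advM, Matrix.sum_apply, pdMat_matField]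

lemma gradVel_vecField : gradVel (vecField V) = matField ((boxCalculus d).grad V) := rfl

lemma strain_vecField : strain (vecField V) = matField ((boxCalculus d).symGrad V) := by
  funext x
  rw [strain, gradVel_vecField, PeriodicCalculus.symGrad, matField_smul, matField_add,
    matField_transpose]

lemma vorticity_vecField : vorticity (vecField V) = matField ((boxCalculus d).skewGrad V) := by
  funext x
  rw [vorticity, gradVel_vecField, PeriodicCalculus.skewGrad, matField_smul, matField_sub,
    matField_transpose]

lemma bulkF_matField : bulkF p (matField A x) = matField (PeriodicCalculus.bulk p A) x := by
  simp only [bulkF, PeriodicCalculus.bulk, matField_add, matField_sub, matField_neg, matField_mul,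
    matField_smul, matField_smul', matField_one, map_smul, ev_trace, smul_eq_mul]

lemma molField_matField : molField p (matField A) = matField ((boxCalculus d).mol p A) := by
  funext x
  rw [molField, lapMat_matField, bulkF_matField, PeriodicCalculus.mol, matField_add, matField_smul]

lemma shifted_matField : shifted (matField A x) = matField (PeriodicCalculus.shift A) x := by
  rw [shifted, PeriodicCalculus.shift, matField_add, matField_smul, matField_one]

lemma tumbling_matField :
    tumbling p (vecField V) (matField A) = matField ((boxCalculus d).tumble p V A) := by
  funext x
  simp only [tumbling, PeriodicCalculus.tumble, strain_vecField, vorticity_vecField,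
    gradVel_vecField, shifted_matField, matField_add, matField_sub, matField_mul, matField_smul,
    matField_smul', map_smul, ev_trace, smul_eq_mul]

lemma gradOdot_matField : gradOdot (matField A) = matField ((boxCalculus d).odot A) := by
  funext x
  ext i j
  simp only [gradOdot, PeriodicCalculus.odot, Matrix.of_apply, matField_apply, ev_contract,
    pdMat_matField]

lemma symStress_matField :
    symStress p (matField A) = matField ((boxCalculus d).stressSym p A) := by
  funext x
  simp only [symStress, PeriodicCalculus.stressSym, molField_matField, gradOdot_matField,
    shifted_matField, matField_add, matField_sub, matField_neg, matField_mul, matField_smul,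
    matField_smul', map_smul, ev_trace, smul_eq_mul]

lemma skewStress_matField :
    skewStress p (matField A) = matField ((boxCalculus d).stressSkew p A) := by
  funext x
  simp only [skewStress, PeriodicCalculus.stressSkew, molField_matField, matField_sub,
    matField_mul]

end Operators

/-! ### The derivative of the bulk term -/

/-- The chain rule for the bulk term. -/
lemma hasDerivAt_bulkF (p : Params) {M : ℝ → Matrix (Fin d) (Fin d) ℝ}
    {B : Matrix (Fin d) (Fin d) ℝ} {s : ℝ}
    (h : ∀ i j, HasDerivAt (fun r => M r i j) (B i j) s) (i j : Fin d) :
    HasDerivAt (fun r => bulkF p (M r) i j) (PeriodicCalculus.bulkDeriv p (M s) B i j) s := by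
  have hmul : ∀ i j, HasDerivAt (fun r => (M r * M r) i j) ((M s * B + B * M s) i j) s := by
    intro i j
    simp only [Matrix.mul_apply, Matrix.add_apply, ← Finset.sum_add_distrib]
    refine (HasDerivAt.fun_sum fun k _ => (h i k).mul (h k j)).congr_deriv ?_
    exact Finset.sum_congr rfl fun k _ => by ring
  have htr : HasDerivAt (fun r => (M r * M r).trace) (2 * (M s * B).trace) s := by
    have : 2 * (M s * B).trace = ∑ k, (M s * B + B * M s) k k := by
      rw [two_mul]
      nth_rw 2 [Matrix.trace_mul_comm]
      simp [Matrix.trace, Finset.sum_add_distrib]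
    rw [this]
    exact HasDerivAt.fun_sum fun k _ => hmul k k
  have hF := (((h i j).const_mul p.a).neg.add
    (((hmul i j).sub ((htr.const_mul (1 / (d : ℝ))).mul_const
      ((1 : Matrix (Fin d) (Fin d) ℝ) i j))).const_mul p.b)).sub
    ((htr.const_mul p.c).mul (h i j))
  refine (hF.congr_deriv ?_).congr_of_eventuallyEq (Filter.Eventually.of_forall fun r => ?_)
  · simp only [PeriodicCalculus.bulkDeriv, Matrix.add_apply, Matrix.sub_apply, Matrix.neg_apply,
      Matrix.smul_apply, smul_eq_mul]
    ring
  · simp [bulkF]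

/-- The chain rule along the line `r ↦ M + rB`. -/
lemma bulkFDeriv_eq (p : Params) (M B : Matrix (Fin d) (Fin d) ℝ) :
    bulkFDeriv p M B = PeriodicCalculus.bulkDeriv p M B := by
  ext i j
  have h : ∀ i j, HasDerivAt (fun r : ℝ => (M + r • B) i j) (B i j) 0 := fun i j => by
    simpa using ((hasDerivAt_id (0 : ℝ)).mul_const (B i j)).const_add (M i j)
  simpa [bulkFDeriv, lineDeriv] using (hasDerivAt_bulkF p h i j).deriv

lemma bulkFDeriv_matField (p : Params) (A B : Matrix (Fin d) (Fin d) (smoothPeriodic d))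
    (x : Fin d → ℝ) : bulkFDeriv p (matField A x) (matField B x)
      = matField (PeriodicCalculus.bulkDeriv p A B) x := by
  simp only [bulkFDeriv_eq, PeriodicCalculus.bulkDeriv, matField_add, matField_sub, matField_neg,
    matField_mul, matField_smul, matField_smul', matField_one, map_smul, ev_trace]

/-! ### The integrals -/

section Integrals

variable (p : Params) (V : Fin d → smoothPeriodic d)
  (A : Matrix (Fin d) (Fin d) (smoothPeriodic d))

/-- Reduces each translation of an integral to a pointwise identity of integrands. -/
lemma cellInt_eq_int {g : (Fin d → ℝ) → ℝ} {f : smoothPeriodic d} (h : ∀ x, g x = ev x f) :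
    cellInt g = (boxCalculus d).int f := by
  rw [show g = fun x => ev x f from funext h]; rfl

lemma J1_eq : J1 (vecField V) = (boxCalculus d).I1 V := by
  refine cellInt_eq_int fun x => ?_
  simp only [advVec_vecField, lapVec_vecField, vecField_apply, map_sum, map_mul]

lemma J2_eq : J2 p (vecField V) (matField A) = (boxCalculus d).I2 p V A := by
  refine congrArg _ (cellInt_eq_int fun x => ?_)
  simp only [molField_matField, vecField_apply, matField_apply, map_sum, map_mul, pd_ev]

lemma J3_eq : J3 p (vecField V) (matField A) = (boxCalculus d).I3 p V A := by
  refine congrArg _ (cellInt_eq_int fun x => ?_)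
  simp only [molField_matField, bulkF_matField, vecField_apply, matField_apply, map_sum, map_mul,
    pd_ev]

lemma J4_eq : J4 p (vecField V) (matField A) = (boxCalculus d).I4 p V A := by
  refine congrArg _ (cellInt_eq_int fun x => ?_)
  simp only [molField_matField, vecField_apply, matField_apply, map_sum, map_mul, map_sub, pd_ev]

lemma J5_eq : J5 p (vecField V) (matField A) = (boxCalculus d).I5 p V A := by
  refine congrArg _ (cellInt_eq_int fun x => ?_)
  simp only [molField_matField, lapMat_matField, vecField_apply, matField_apply, map_sum, map_mul,
    map_sub, pd_ev]

lemma J6_eq : J6 p (vecField V) (matField A) = (boxCalculus d).I6 p V A := by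
  refine congrArg _ (cellInt_eq_int fun x => ?_)
  simp only [molField_matField, lapMat_matField, strain_vecField, ev_contract, matField_add,
    matField_mul]

lemma J7_eq : J7 p (vecField V) (matField A) = (boxCalculus d).I7 p V A := by
  refine congrArg _ (cellInt_eq_int fun x => ?_)
  simp only [molField_matField, strain_vecField, matField_apply, map_sum, map_mul, pd_ev]

lemma J8_eq : J8 p (vecField V) (matField A) = (boxCalculus d).I8 p V A := by
  refine congrArg _ (cellInt_eq_int fun x => ?_)
  simp only [molField_matField, vecField_apply, matField_apply, map_sum, map_mul, pd_ev, ← lap_ev]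

lemma J9_eq : J9 p (vecField V) (matField A) = (boxCalculus d).I9 p V A := by
  refine congrArg _ (cellInt_eq_int fun x => ?_)
  -- The differentiated product must become one algebra element before `map_mul` separates the outer
  -- factors.
  simp only [molField_matField, vecField_apply, matField_apply, map_sum, pd_ev_mul, pd_ev]
  simp only [map_mul]

lemma J10_eq : J10 p (vecField V) (matField A) = (boxCalculus d).I10 p V A := by
  refine congrArg _ (cellInt_eq_int fun x => ?_)
  rw [molField_matField, advMat_matField, bulkFDeriv_matField, ev_contract]

lemma J11_eq : J11 p (vecField V) (matField A) = (boxCalculus d).I11 p V A := by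
  refine congrArg _ (cellInt_eq_int fun x => ?_)
  rw [molField_matField, tumbling_matField, bulkFDeriv_matField, ev_contract]

lemma J12_eq : J12 p (matField A) = (boxCalculus d).I12 p A := by
  refine congrArg _ (cellInt_eq_int fun x => ?_)
  rw [molField_matField, bulkFDeriv_matField, ev_contract]

lemma velTermA_eq : velTermA p (vecField V) (matField A) = (boxCalculus d).velA p V A := by
  refine congrArg _ (cellInt_eq_int fun x => ?_)
  simp only [skewStress_matField, divMat_matField, lapVec_vecField, vecField_apply, map_sum,
    map_mul]

lemma molTermA_eq : molTermA p (vecField V) (matField A) = (boxCalculus d).molA p V A := by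
  refine congrArg _ (cellInt_eq_int fun x => ?_)
  simp only [molField_matField, lapVec_vecField, vecField_apply, matField_apply, ← map_mul,
    ← map_sub, pd_ev, ← map_sum]

lemma velTermB_eq : velTermB p (vecField V) (matField A) = (boxCalculus d).velB p V A := by
  refine congrArg _ (cellInt_eq_int fun x => ?_)
  simp only [gradOdot_matField, divMat_matField, lapVec_vecField, vecField_apply, map_sum,
    map_mul]

lemma molTermB_eq : molTermB p (vecField V) (matField A) = (boxCalculus d).molB p V A := by
  refine congrArg _ (cellInt_eq_int fun x => ?_)
  simp only [molField_matField, lapVec_vecField, vecField_apply, matField_apply, map_sum, map_mul,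
    pd_ev]

lemma velTermC_eq : velTermC p (vecField V) (matField A) = (boxCalculus d).velC p V A := by
  refine congrArg _ (cellInt_eq_int fun x => ?_)
  simp only [molField_matField, ← matField_mul, ← matField_add, ← matField_smul]
  rw [map_sum]
  exact Finset.sum_congr rfl fun i _ => by
    rw [map_mul, divMat_matField, lapVec_vecField, vecField_apply, vecField_apply]

lemma molTermC_eq : molTermC p (vecField V) (matField A) = (boxCalculus d).molC p V A := by
  refine congrArg _ (cellInt_eq_int fun x => ?_)
  simp only [molField_matField, strain_vecField, lapMat_matField, ev_contract, matField_add,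
    matField_mul, matField_smul]

lemma velTermD_eq : velTermD p (vecField V) (matField A) = (boxCalculus d).velD p V A := by
  refine congrArg _ (cellInt_eq_int fun x => ?_)
  simp only [molField_matField, shifted_matField, ← ev_contract, ← matField_smul']
  rw [map_sum]
  exact Finset.sum_congr rfl fun i _ => by
    rw [map_mul, divMat_matField, lapVec_vecField, vecField_apply, vecField_apply]

lemma molTermD_eq : molTermD p (vecField V) (matField A) = (boxCalculus d).molD p V A := by
  refine congrArg _ (cellInt_eq_int fun x => ?_)
  simp only [molField_matField, ← ev_contract, ← matField_smul']
  rw [map_sum]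
  exact Finset.sum_congr rfl fun i _ => by
    rw [map_mul, divMat_matField, lapVec_vecField, vecField_apply, vecField_apply]

end Integrals

/-! ### Functions of time and space -/

/-- Smoothness jointly in positive time and space. -/
def SpaceTimeSmooth (f : ℝ → (Fin d → ℝ) → ℝ) : Prop :=
  ContDiffOn ℝ ∞ (fun z : ℝ × (Fin d → ℝ) => f z.1 z.2) (Set.Ioi 0 ×ˢ Set.univ)

lemma isOpen_positiveTimes : IsOpen (Set.Ioi (0 : ℝ) ×ˢ (Set.univ : Set (Fin d → ℝ))) :=
  isOpen_Ioi.prod isOpen_univ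

namespace SpaceTimeSmooth

variable {f g : ℝ → (Fin d → ℝ) → ℝ}

lemma add (hf : SpaceTimeSmooth f) (hg : SpaceTimeSmooth g) :
    SpaceTimeSmooth fun s x => f s x + g s x := ContDiffOn.add hf hg

lemma sub (hf : SpaceTimeSmooth f) (hg : SpaceTimeSmooth g) :
    SpaceTimeSmooth fun s x => f s x - g s x := ContDiffOn.sub hf hg

lemma mul (hf : SpaceTimeSmooth f) (hg : SpaceTimeSmooth g) :
    SpaceTimeSmooth fun s x => f s x * g s x := ContDiffOn.mul hf hg

lemma const (c : ℝ) : SpaceTimeSmooth fun (_ : ℝ) (_ : Fin d → ℝ) => c := contDiffOn_const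

lemma neg (hf : SpaceTimeSmooth f) : SpaceTimeSmooth fun s x => -f s x := ContDiffOn.neg hf

lemma sum {ι : Type*} [Fintype ι] {f : ι → ℝ → (Fin d → ℝ) → ℝ}
    (hf : ∀ i, SpaceTimeSmooth (f i)) : SpaceTimeSmooth fun s x => ∑ i, f i s x :=
  ContDiffOn.sum fun i _ => hf i

lemma contDiffAt (hf : SpaceTimeSmooth f) {t : ℝ} (ht : 0 < t) (x : Fin d → ℝ) :
    ContDiffAt ℝ ∞ (fun z : ℝ × (Fin d → ℝ) => f z.1 z.2) (t, x) :=
  ContDiffOn.contDiffAt hf (isOpen_positiveTimes.mem_nhds ⟨ht, trivial⟩)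

lemma hasFDerivAt (hf : SpaceTimeSmooth f) {t : ℝ} (ht : 0 < t) (x : Fin d → ℝ) :
    HasFDerivAt (fun z : ℝ × (Fin d → ℝ) => f z.1 z.2)
      (fderiv ℝ (fun z : ℝ × (Fin d → ℝ) => f z.1 z.2) (t, x)) (t, x) :=
  ((hf.contDiffAt ht x).differentiableAt (by simp)).hasFDerivAt

lemma contDiff_slice (hf : SpaceTimeSmooth f) {t : ℝ} (ht : 0 < t) : ContDiff ℝ ∞ (f t) :=
  contDiff_iff_contDiffAt.2 fun x =>
    (hf.contDiffAt ht x).comp (f := fun y => (t, y)) x (contDiffAt_const.prodMk contDiffAt_id)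

/-- Viewing `∂_k` as a joint space-time derivative in the direction `(0, e_k)` yields both the joint
smoothness of `∂_k f` and its commutation with `∂_t`. -/
lemma pd_eq (hf : SpaceTimeSmooth f) {t : ℝ} (ht : 0 < t) (x : Fin d → ℝ) (k : Fin d) :
    pd k (f t) x = fderiv ℝ (fun z : ℝ × (Fin d → ℝ) => f z.1 z.2) (t, x) (0, Pi.single k 1) := by
  have h := (hf.hasFDerivAt ht x).comp (f := fun y => (t, y)) x
    ((hasFDerivAt_const t x).prodMk (hasFDerivAt_id x))
  rw [pd, show f t = (fun z : ℝ × (Fin d → ℝ) => f z.1 z.2) ∘ fun y => (t, y) from rfl, h.fderiv]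
  simp

lemma hasDerivAt_fderiv (hf : SpaceTimeSmooth f) {t : ℝ} (ht : 0 < t) (x : Fin d → ℝ) :
    HasDerivAt (fun s => f s x)
      (fderiv ℝ (fun z : ℝ × (Fin d → ℝ) => f z.1 z.2) (t, x) (1, 0)) t :=
  (hf.hasFDerivAt ht x).comp_hasDerivAt (f := fun s => (s, x)) t
    ((hasDerivAt_id t).prodMk (hasDerivAt_const t x))

lemma hasDerivAt (hf : SpaceTimeSmooth f) {t : ℝ} (ht : 0 < t) (x : Fin d → ℝ) :
    HasDerivAt (fun s => f s x) (deriv (fun s => f s x) t) t :=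
  (hf.hasDerivAt_fderiv ht x).differentiableAt.hasDerivAt

lemma contDiffOn_fderiv_apply (hf : SpaceTimeSmooth f) (a : ℝ × (Fin d → ℝ)) :
    ContDiffOn ℝ ∞ (fun z => fderiv ℝ (fun z : ℝ × (Fin d → ℝ) => f z.1 z.2) z a)
      (Set.Ioi 0 ×ˢ Set.univ) :=
  (ContDiffOn.fderiv_of_isOpen (m := ∞) hf isOpen_positiveTimes (by norm_cast)).clm_apply
    contDiffOn_const

lemma pd (hf : SpaceTimeSmooth f) (k : Fin d) : SpaceTimeSmooth fun s => pd k (f s) :=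
  (hf.contDiffOn_fderiv_apply (0, Pi.single k 1)).congr fun z hz => hf.pd_eq hz.1 z.2 k

lemma timeDeriv (hf : SpaceTimeSmooth f) :
    SpaceTimeSmooth fun t x => deriv (fun s => f s x) t :=
  (hf.contDiffOn_fderiv_apply (1, 0)).congr fun z hz => (hf.hasDerivAt_fderiv hz.1 z.2).deriv

/-- The time derivative commutes with partial derivatives. -/
lemma deriv_pd (hf : SpaceTimeSmooth f) {t : ℝ} (ht : 0 < t) (x : Fin d → ℝ) (k : Fin d) :
    deriv (fun s => BerisEdwards.pd k (f s) x) t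
      = BerisEdwards.pd k (fun y => deriv (fun s => f s y) t) x := by
  rw [hf.timeDeriv.pd_eq ht x k, ((hf.pd k).hasDerivAt_fderiv ht x).deriv]
  have hn : (Set.Ioi (0 : ℝ) ×ˢ (Set.univ : Set (Fin d → ℝ))) ∈ nhds (t, x) :=
    isOpen_positiveTimes.mem_nhds ⟨ht, trivial⟩
  -- Since these functions are differentiated once more, equality is needed on a neighbourhood of
  -- `(t, x)`.
  have h1 : (fun z : ℝ × (Fin d → ℝ) => BerisEdwards.pd k (f z.1) z.2) =ᶠ[nhds (t, x)]
      fun z => fderiv ℝ (fun z : ℝ × (Fin d → ℝ) => f z.1 z.2) z (0, Pi.single k 1) :=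
    Filter.eventually_of_mem hn fun z hz => hf.pd_eq hz.1 z.2 k
  have h2 : (fun z : ℝ × (Fin d → ℝ) => deriv (fun s => f s z.2) z.1) =ᶠ[nhds (t, x)]
      fun z => fderiv ℝ (fun z : ℝ × (Fin d → ℝ) => f z.1 z.2) z (1, 0) :=
    Filter.eventually_of_mem hn fun z hz => (hf.hasDerivAt_fderiv hz.1 z.2).deriv
  rw [h1.fderiv_eq, h2.fderiv_eq, fderiv_fderiv_comm (hf.contDiffAt ht x)]

/-- Differentiation under the integral over the cell. -/
lemma hasDerivAt_cellInt (hf : SpaceTimeSmooth f) {t : ℝ} (ht : 0 < t) :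
    HasDerivAt (fun s => cellInt (f s)) (cellInt fun x => deriv (fun s => f s x) t) t := by
  -- The window `[t/2, 2t]` is compact and stays in positive times, so the continuous time
  -- derivative is bounded by a constant on window times cell.
  have hpos : ∀ s ∈ Set.Icc (t / 2) (2 * t), 0 < s := fun s hs => by linarith [hs.1]
  have hK : IsCompact (Set.Icc (t / 2) (2 * t) ×ˢ Set.Icc (0 : Fin d → ℝ) 1) :=
    isCompact_Icc.prod isCompact_Icc
  obtain ⟨C, hC⟩ := hK.exists_bound_of_continuousOn
    (hf.timeDeriv.continuousOn.mono fun z hz => ⟨hpos z.1 hz.1, trivial⟩)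
  refine (hasDerivAt_integral_of_dominated_loc_of_deriv_le (bound := fun _ => C)
    (F' := fun s x => deriv (fun r => f r x) s)
    (Icc_mem_nhds (a := t / 2) (b := 2 * t) (by linarith) (by linarith))
    ?_ ?_ ?_ ?_ ?_ ?_).2
  · filter_upwards [Ioi_mem_nhds ht] with s hs
    exact (integrableOn_cell (hf.contDiff_slice hs).continuous).aestronglyMeasurable
  · exact integrableOn_cell (hf.contDiff_slice ht).continuous
  · exact (integrableOn_cell (hf.timeDeriv.contDiff_slice ht).continuous).aestronglyMeasurable
  · exact (MeasureTheory.ae_restrict_iff' measurableSet_Icc).2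
      (Filter.Eventually.of_forall fun x hx s hs => hC (s, x) ⟨hs, hx⟩)
  · exact integrableOn_cell continuous_const
  · exact Filter.Eventually.of_forall fun x s hs => hf.hasDerivAt (hpos s hs) x

end SpaceTimeSmooth

/-! ### Solutions -/

namespace IsSmoothSolution

variable {p : Params} {u : ℝ → (Fin d → ℝ) → Fin d → ℝ} {P : ℝ → (Fin d → ℝ) → ℝ}
  {Q : ℝ → (Fin d → ℝ) → Matrix (Fin d) (Fin d) ℝ}

lemma spaceTimeSmooth_molField (h : IsSmoothSolution p u P Q) (i j : Fin d) :
    SpaceTimeSmooth fun s x => molField p (Q s) x i j := by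
  have hQ : ∀ i j, SpaceTimeSmooth fun s x => Q s x i j := h.smooth_Q
  have hmul : ∀ i j, SpaceTimeSmooth fun s x => (Q s x * Q s x) i j := fun i j =>
    SpaceTimeSmooth.sum fun k => (hQ i k).mul (hQ k j)
  have htr : SpaceTimeSmooth fun s x => (Q s x * Q s x).trace :=
    SpaceTimeSmooth.sum fun k => hmul k k
  exact ((SpaceTimeSmooth.const p.L).mul
      (SpaceTimeSmooth.sum fun k => ((hQ i j).pd k).pd k)).add
    (((((SpaceTimeSmooth.const p.a).mul (hQ i j)).neg).add
      ((SpaceTimeSmooth.const p.b).mul ((hmul i j).sub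
        (((SpaceTimeSmooth.const (1 / (d : ℝ))).mul htr).mul (SpaceTimeSmooth.const _))))).sub
      (((SpaceTimeSmooth.const p.c).mul htr).mul (hQ i j)))

variable {t : ℝ}

/-- The components of the velocity as smooth periodic functions. -/
def vel (h : IsSmoothSolution p u P Q) (ht : 0 < t) (i : Fin d) : smoothPeriodic d :=
  ⟨fun x => u t x i, SpaceTimeSmooth.contDiff_slice (f := fun s x => u s x i) (h.smooth_u i) ht,
    fun x k => congrFun (h.periodic_u t ht x k) i⟩

/-- The pressure as a smooth periodic function. -/
def pres (h : IsSmoothSolution p u P Q) (ht : 0 < t) : smoothPeriodic d :=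
  ⟨P t, h.smooth_P t ht, h.periodic_P t ht⟩

/-- The entries of the order parameter as smooth periodic functions. -/
def ord (h : IsSmoothSolution p u P Q) (ht : 0 < t) :
    Matrix (Fin d) (Fin d) (smoothPeriodic d) := Matrix.of fun i j =>
  ⟨fun x => Q t x i j,
    SpaceTimeSmooth.contDiff_slice (f := fun s x => Q s x i j) (h.smooth_Q i j) ht,
    fun x k => congrArg (fun M : Matrix (Fin d) (Fin d) ℝ => M i j) (h.periodic_Q t ht x k)⟩

lemma vecField_vel (h : IsSmoothSolution p u P Q) (ht : 0 < t) : vecField (h.vel ht) = u t := rfl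

lemma matField_ord (h : IsSmoothSolution p u P Q) (ht : 0 < t) : matField (h.ord ht) = Q t := rfl

lemma div_vel (h : IsSmoothSolution p u P Q) (ht : 0 < t) :
    (boxCalculus d).div (h.vel ht) = 0 := smoothPeriodic_ext fun x => by
  rw [← divVec_vecField, vecField_vel, h.incompressible t ht, map_zero]

lemma isSymm_ord (h : IsSmoothSolution p u P Q) (ht : 0 < t) : (h.ord ht).IsSymm := by
  ext1 i j
  exact smoothPeriodic_ext fun x => (h.symm_Q t ht x).apply i j

lemma trace_ord (h : IsSmoothSolution p u P Q) (ht : 0 < t) : (h.ord ht).trace = 0 :=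
  smoothPeriodic_ext fun x => by rw [ev_trace, matField_ord, h.trace_Q t ht, map_zero]

/-- The momentum equation solved for `u_t`; this makes `u_t` an element of the algebra, in
particular periodic. -/
lemma deriv_u (h : IsSmoothSolution p u P Q) (ht : 0 < t) (x : Fin d → ℝ) (i : Fin d) :
    deriv (fun s => u s x i) t
      = ev x ((boxCalculus d).accel p (h.vel ht) (h.pres ht) (h.ord ht) i) := by
  have hm := h.momentum t ht x i
  have hs : (fun y => symStress p (Q t) y + skewStress p (Q t) y) = matField
      ((boxCalculus d).stressSym p (h.ord ht) + (boxCalculus d).stressSkew p (h.ord ht)) := by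
    funext y
    rw [matField_add, ← symStress_matField, ← skewStress_matField, matField_ord]
  have hP : BerisEdwards.pd i (P t) x = ev x ((boxCalculus d).der i (h.pres ht)) := rfl
  rw [hs, divMat_matField, hP, ← h.vecField_vel ht, advVec_vecField, lapVec_vecField] at hm
  simp only [vecField_apply] at hm
  simp only [PeriodicCalculus.accel, map_add, map_sub, map_neg, map_smul, smul_eq_mul]
  linarith

lemma deriv_Q (h : IsSmoothSolution p u P Q) (ht : 0 < t) (x : Fin d → ℝ) (i j : Fin d) :
    deriv (fun s => Q s x i j) t
      = ev x ((boxCalculus d).rate p (h.vel ht) (h.ord ht) i j) := by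
  have ho := h.order t ht x i j
  rw [← h.vecField_vel ht, ← h.matField_ord ht, advMat_matField, tumbling_matField,
    molField_matField] at ho
  simp only [matField_apply] at ho
  simp only [PeriodicCalculus.rate, Matrix.add_apply, Matrix.neg_apply, Matrix.smul_apply,
    map_add, map_neg, map_smul, smul_eq_mul]
  linarith

lemma hasDerivAt_gradVelSq (h : IsSmoothSolution p u P Q) (ht : 0 < t) :
    HasDerivAt (fun s => gradVelSq (u s)) (2 * (boxCalculus d).int (∑ i, ∑ j,
      (boxCalculus d).der j (h.vel ht i) * (boxCalculus d).der j
        ((boxCalculus d).accel p (h.vel ht) (h.pres ht) (h.ord ht) i))) t := by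
  have hu : ∀ i, SpaceTimeSmooth fun s x => u s x i := h.smooth_u
  have hs : SpaceTimeSmooth fun s x => frob (gradVel (u s) x) (gradVel (u s) x) :=
    SpaceTimeSmooth.sum fun i => SpaceTimeSmooth.sum fun j => ((hu i).pd j).mul ((hu i).pd j)
  refine (hs.hasDerivAt_cellInt ht).congr_deriv ?_
  rw [← smul_eq_mul, ← map_smul]
  refine cellInt_eq_int fun x => HasDerivAt.deriv ?_
  have hd : ∀ i j, HasDerivAt (fun s => gradVel (u s) x i j) (ev x ((boxCalculus d).der j
      ((boxCalculus d).accel p (h.vel ht) (h.pres ht) (h.ord ht) i))) t := fun i j => by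
    refine (((hu i).pd j).hasDerivAt ht x).congr_deriv ?_
    rw [(hu i).deriv_pd ht x j]
    simp only [h.deriv_u ht, pd_ev]
  refine (HasDerivAt.fun_sum fun i _ => HasDerivAt.fun_sum fun j _ =>
    (hd i j).mul (hd i j)).congr_deriv ?_
  simp only [map_smul, map_sum, map_mul, smul_eq_mul, Finset.mul_sum]
  refine Finset.sum_congr rfl fun i _ => Finset.sum_congr rfl fun j _ => ?_
  rw [show gradVel (u t) x i j = ev x ((boxCalculus d).der j (h.vel ht i)) from rfl]
  ring

lemma hasDerivAt_molSq (h : IsSmoothSolution p u P Q) (ht : 0 < t) :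
    HasDerivAt (fun s => molSq p (Q s)) (2 * (boxCalculus d).int (PeriodicCalculus.contract
      ((boxCalculus d).molRate p (h.ord ht) ((boxCalculus d).rate p (h.vel ht) (h.ord ht)))
      ((boxCalculus d).mol p (h.ord ht)))) t := by
  have hQ : ∀ i j, SpaceTimeSmooth fun s x => Q s x i j := h.smooth_Q
  have hH := h.spaceTimeSmooth_molField
  have hs : SpaceTimeSmooth fun s x => frob (molField p (Q s) x) (molField p (Q s) x) :=
    SpaceTimeSmooth.sum fun i => SpaceTimeSmooth.sum fun j => (hH i j).mul (hH i j)
  refine (hs.hasDerivAt_cellInt ht).congr_deriv ?_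
  rw [← smul_eq_mul, ← map_smul]
  refine cellInt_eq_int fun x => HasDerivAt.deriv ?_
  set B := (boxCalculus d).rate p (h.vel ht) (h.ord ht)
  have hd : ∀ i j, HasDerivAt (fun s => molField p (Q s) x i j)
      (ev x ((boxCalculus d).molRate p (h.ord ht) B i j)) t := fun i j => by
    -- The time derivative passes through both spatial derivatives, and only then is `Q_t` replaced
    -- by the equation.
    have hlap : HasDerivAt (fun s => lapMat (Q s) x i j)
        (ev x ((boxCalculus d).laplaceM B i j)) t := by
      rw [PeriodicCalculus.laplaceM_apply, PeriodicCalculus.laplace_apply, map_sum]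
      change HasDerivAt (fun s => ∑ k, BerisEdwards.pd k (BerisEdwards.pd k fun y => Q s y i j) x)
        _ t
      refine HasDerivAt.fun_sum fun k _ =>
        ((((hQ i j).pd k).pd k).hasDerivAt ht x).congr_deriv ?_
      rw [((hQ i j).pd k).deriv_pd ht x k]
      simp only [(hQ i j).deriv_pd ht, h.deriv_Q ht, pd_ev, B]
    have hF := hasDerivAt_bulkF p (M := fun s => Q s x) (B := matField B x) (s := t)
      (fun i j => ((hQ i j).hasDerivAt ht x).congr_deriv (h.deriv_Q ht x i j)) i j
    refine ((hlap.const_mul p.L).add hF).congr_deriv ?_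
    rw [← bulkFDeriv_eq, ← h.matField_ord ht, bulkFDeriv_matField, matField_apply,
      PeriodicCalculus.molRate, Matrix.add_apply, map_add, Matrix.smul_apply, map_smul,
      smul_eq_mul]
  refine (HasDerivAt.fun_sum fun i _ => HasDerivAt.fun_sum fun j _ =>
    (hd i j).mul (hd i j)).congr_deriv ?_
  simp only [PeriodicCalculus.contract, map_smul, map_sum, map_mul, smul_eq_mul, Finset.mul_sum]
  refine Finset.sum_congr rfl fun i _ => Finset.sum_congr rfl fun j _ => ?_
  rw [← h.matField_ord ht, molField_matField, matField_apply]
  ring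

end IsSmoothSolution

/-! ### Dissipation norms and the two balances for solutions -/

lemma lapVelSq_vecField (V : Fin d → smoothPeriodic d) : lapVelSq (vecField V)
    = (boxCalculus d).int (∑ i, (boxCalculus d).laplace (V i) ^ 2) := by
  refine cellInt_eq_int fun x => ?_
  simp only [lapVec_vecField, vecField_apply, map_sum, map_pow]

lemma gradMolSq_matField (p : Params) (A : Matrix (Fin d) (Fin d) (smoothPeriodic d)) :
    gradMolSq p (matField A) = (boxCalculus d).int (∑ k, PeriodicCalculus.contract
      ((boxCalculus d).derM k ((boxCalculus d).mol p A))
      ((boxCalculus d).derM k ((boxCalculus d).mol p A))) := by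
  refine cellInt_eq_int fun x => ?_
  simp only [molField_matField, pdMat_matField, map_sum, ev_contract]

namespace IsSmoothSolution

variable {p : Params} {u : ℝ → (Fin d → ℝ) → Fin d → ℝ} {P : ℝ → (Fin d → ℝ) → ℝ}
  {Q : ℝ → (Fin d → ℝ) → Matrix (Fin d) (Fin d) ℝ} {t : ℝ}

/-- The balance of `‖∇u‖²`. -/
theorem gradVelSq_balance (h : IsSmoothSolution p u P Q) (ht : 0 < t) :
    1 / 2 * deriv (fun s => gradVelSq (u s)) t + p.ν * lapVelSq (u t)
      = J1 (u t) + velTermA p (u t) (Q t) + velTermB p (u t) (Q t) + velTermC p (u t) (Q t)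
        + velTermD p (u t) (Q t) := by
  rw [(h.hasDerivAt_gradVelSq ht).deriv, ← h.vecField_vel ht, ← h.matField_ord ht,
    lapVelSq_vecField, J1_eq, velTermA_eq, velTermB_eq, velTermC_eq, velTermD_eq,
    ← (boxCalculus d).gradient_balance p (h.pres ht) (h.div_vel ht) (h.isSymm_ord ht)]
  ring

/-- The balance of `‖H‖²`. -/
theorem molSq_balance (h : IsSmoothSolution p u P Q) (hd : d ≠ 0) (hL : p.L ≠ 0) (ht : 0 < t) :
    p.lam / p.L * (1 / 2 * deriv (fun s => molSq p (Q s)) t) + p.lam * p.Γ * gradMolSq p (Q t)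
      = molTermA p (u t) (Q t) + molTermB p (u t) (Q t) + molTermC p (u t) (Q t)
        + molTermD p (u t) (Q t) + J2 p (u t) (Q t) + J3 p (u t) (Q t) + J4 p (u t) (Q t)
        + J5 p (u t) (Q t) + J6 p (u t) (Q t) + J7 p (u t) (Q t) + J8 p (u t) (Q t)
        + J9 p (u t) (Q t) + J10 p (u t) (Q t) + J11 p (u t) (Q t) + J12 p (Q t) := by
  rw [(h.hasDerivAt_molSq ht).deriv, ← h.vecField_vel ht, ← h.matField_ord ht,
    gradMolSq_matField, molTermA_eq, molTermB_eq, molTermC_eq, molTermD_eq, J2_eq, J3_eq, J4_eq,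
    J5_eq, J6_eq, J7_eq, J8_eq, J9_eq, J10_eq, J11_eq, J12_eq,
    ← (boxCalculus d).mol_balance p (h.vel ht) hd hL (h.div_vel ht) (h.isSymm_ord ht)
      (h.trace_ord ht)]
  ring

end IsSmoothSolution

end BerisEdwards

end

/-! ### Assembling the balances and the cancellations -/

theorem mainTheorem6 (d : ℕ) (hd : d = 2 ∨ d = 3)
    (p : BerisEdwards.Params) (hp : p.Admissible)
    (u : ℝ → (Fin d → ℝ) → Fin d → ℝ) (P : ℝ → (Fin d → ℝ) → ℝ)
    (Q : ℝ → (Fin d → ℝ) → Matrix (Fin d) (Fin d) ℝ)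
    (hsol : BerisEdwards.IsSmoothSolution p u P Q) (t : ℝ) (ht : 0 < t) :
    -- the identity for the derivative of A
    (DifferentiableAt ℝ (fun s => BerisEdwards.energyA p (u s) (Q s)) t ∧
      1 / 2 * deriv (fun s => BerisEdwards.energyA p (u s) (Q s)) t
          + p.ν * BerisEdwards.lapVelSq (u t) + p.lam * p.Γ * BerisEdwards.gradMolSq p (Q t)
        = BerisEdwards.J1 (u t) + BerisEdwards.J2 p (u t) (Q t) + BerisEdwards.J3 p (u t) (Q t)
          + BerisEdwards.J4 p (u t) (Q t) + BerisEdwards.J5 p (u t) (Q t)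
          + BerisEdwards.J6 p (u t) (Q t) + BerisEdwards.J7 p (u t) (Q t)
          + BerisEdwards.J8 p (u t) (Q t) + BerisEdwards.J9 p (u t) (Q t)
          + BerisEdwards.J10 p (u t) (Q t) + BerisEdwards.J11 p (u t) (Q t)
          + BerisEdwards.J12 p (Q t)) ∧
    -- the balance of the squared norm of the velocity gradient
    (DifferentiableAt ℝ (fun s => BerisEdwards.gradVelSq (u s)) t ∧
      1 / 2 * deriv (fun s => BerisEdwards.gradVelSq (u s)) t
          + p.ν * BerisEdwards.lapVelSq (u t)
        = BerisEdwards.J1 (u t) + BerisEdwards.velTermA p (u t) (Q t)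
          + BerisEdwards.velTermB p (u t) (Q t) + BerisEdwards.velTermC p (u t) (Q t)
          + BerisEdwards.velTermD p (u t) (Q t)) ∧
    -- the balance of the squared norm of H
    (DifferentiableAt ℝ (fun s => BerisEdwards.molSq p (Q s)) t ∧
      p.lam / p.L * (1 / 2 * deriv (fun s => BerisEdwards.molSq p (Q s)) t)
          + p.lam * p.Γ * BerisEdwards.gradMolSq p (Q t)
        = BerisEdwards.molTermA p (u t) (Q t) + BerisEdwards.molTermB p (u t) (Q t)
          + BerisEdwards.molTermC p (u t) (Q t) + BerisEdwards.molTermD p (u t) (Q t)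
          + BerisEdwards.J2 p (u t) (Q t) + BerisEdwards.J3 p (u t) (Q t)
          + BerisEdwards.J4 p (u t) (Q t) + BerisEdwards.J5 p (u t) (Q t)
          + BerisEdwards.J6 p (u t) (Q t) + BerisEdwards.J7 p (u t) (Q t)
          + BerisEdwards.J8 p (u t) (Q t) + BerisEdwards.J9 p (u t) (Q t)
          + BerisEdwards.J10 p (u t) (Q t) + BerisEdwards.J11 p (u t) (Q t)
          + BerisEdwards.J12 p (Q t)) ∧
    -- the four cancellations
    BerisEdwards.velTermA p (u t) (Q t) + BerisEdwards.molTermA p (u t) (Q t) = 0 ∧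
    BerisEdwards.velTermB p (u t) (Q t) + BerisEdwards.molTermB p (u t) (Q t) = 0 ∧
    BerisEdwards.velTermC p (u t) (Q t) + BerisEdwards.molTermC p (u t) (Q t) = 0 ∧
    BerisEdwards.velTermD p (u t) (Q t) + BerisEdwards.molTermD p (u t) (Q t) = 0 ∧
    -- the terms of the last two cancellations are absent when ξ = 0
    (p.ξ = 0 → BerisEdwards.velTermC p (u t) (Q t) = 0 ∧ BerisEdwards.molTermC p (u t) (Q t) = 0 ∧
      BerisEdwards.velTermD p (u t) (Q t) = 0 ∧ BerisEdwards.molTermD p (u t) (Q t) = 0) := by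
  have hd0 : d ≠ 0 := by omega
  have hL := hp.L_pos.ne'
  have hu := (hsol.hasDerivAt_gradVelSq ht).differentiableAt
  have hH := (hsol.hasDerivAt_molSq ht).differentiableAt
  have bu := hsol.gradVelSq_balance ht
  have bH := hsol.molSq_balance hd0 hL ht
  have hv := hsol.div_vel ht
  have hQ := hsol.isSymm_ord ht
  have htr := hsol.trace_ord ht
  have cA := (BerisEdwards.boxCalculus d).velA_add_molA p (hsol.vel ht) (Q := hsol.ord ht)
  have cB := (BerisEdwards.boxCalculus d).velB_add_molB p (hsol.vel ht) hv hQ htr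
  have cC := (BerisEdwards.boxCalculus d).velC_add_molC p (hsol.vel ht) hQ
  have cD := (BerisEdwards.boxCalculus d).velD_add_molD p (hsol.vel ht) (Q := hsol.ord ht) hv
  rw [← BerisEdwards.velTermA_eq, ← BerisEdwards.molTermA_eq, hsol.vecField_vel,
    hsol.matField_ord] at cA
  rw [← BerisEdwards.velTermB_eq, ← BerisEdwards.molTermB_eq, hsol.vecField_vel,
    hsol.matField_ord] at cB
  rw [← BerisEdwards.velTermC_eq, ← BerisEdwards.molTermC_eq, hsol.vecField_vel,
    hsol.matField_ord] at cC
  rw [← BerisEdwards.velTermD_eq, ← BerisEdwards.molTermD_eq, hsol.vecField_vel,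
    hsol.matField_ord] at cD
  refine ⟨⟨hu.add (hH.const_mul _), ?_⟩, ⟨hu, bu⟩, ⟨hH, bH⟩, cA, cB, cC, cD, fun hξ => ?_⟩
  · have e : deriv (fun s => BerisEdwards.energyA p (u s) (Q s)) t
        = deriv (fun s => BerisEdwards.gradVelSq (u s)) t
          + p.lam / p.L * deriv (fun s => BerisEdwards.molSq p (Q s)) t :=
      (hu.hasDerivAt.add (hH.hasDerivAt.const_mul _)).deriv
    rw [e]
    -- Adding the two balances leaves the four sums `X + Y`, which the cancellations remove.
    linear_combination bu + bH + cA + cB + cC + cD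
  · simp [BerisEdwards.velTermC, BerisEdwards.molTermC, BerisEdwards.velTermD,
      BerisEdwards.molTermD, hξ]
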